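/- Throughout we work over $\mathbb C$. Let $\varkappa=m+n$, let $\boldsymbol s=(s_1,\dots,s_\varkappa)$ and $\boldsymbol\varepsilon=(\varepsilon_1,\dots,\varepsilon_\varkappa)$ be arbitrary sequences of signs $\pm1$ ($m$ being the number of $i$ with $s_i=1$), and define $|i|\in\mathbb Z/2$ by $s_i=(-1)^{|i|}$. Brackets are supercommutators, a generator with indices $i,j$ having parity $|i|+|j|$. The super Yangian $\mathscr Y_{\boldsymbol s}$ is the unital associative superalgebra with generators $t_{ij}^{(r)}$ ($1\le i,j\le\varkappa$, $r\ge1$) and relations, for $t_{ij}(u)=\delta_{ij}+\sum_{r\ge1}t_{ij}^{(r)}u^{-r}$, $$(u-v)[t_{ij}(u),t_{kl}(v)]=(-1)^{|i||j|+|i||k|+|j||k|}\big(t_{kj}(u)t_{il}(v)-t_{kj}(v)t_{il}(u)\big).$$ For $\boldsymbol\lambda(u)=(\lambda_i(u))_{i}$ with $\lambda_i(u)\in1+u^{-1}\mathbb C[[u^{-1}]]$, $L(\boldsymbol\lambda(u))$ denotes the (unique up to isomorphism) irreducible $\mathscr Y_{\boldsymbol s}$-module generated by a nonzero vector $\xi$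 with $t_{ij}(u)\xi=0$ for $i<j$ and $t_{ii}(u)\xi=\lambda_i(u)\xi$. The twisted super Yangian $\mathscr B_{\boldsymbol s,\boldsymbol\varepsilon}$ is the unital associative superalgebra with generators $b_{ij}^{(r)}$ ($1\le i,j\le\varkappa$, $r\ge1$) and relations, for $b_{ij}(u)=\delta_{ij}\varepsilon_i+\sum_{r\ge1}b_{ij}^{(r)}u^{-r}$, $$\begin{aligned}[][b_{ij}(u),b_{kl}(v)]={}&\tfrac{(-1)^{|i||j|+|i||k|+|j||k|}}{u-v}\big(b_{kj}(u)b_{il}(v)-b_{kj}(v)b_{il}(u)\big)\\&+\tfrac{(-1)^{|i||j|+|i||k|+|j||k|}}{u+v}\Big(\delta_{kj}\sum_a b_{ia}(u)b_{al}(v)-\delta_{il}\sum_a b_{ka}(v)b_{aj}(u)\Big)\\&-\tfrac{\delta_{ij}}{u^2-v^2}\Big(\sum_a b_{ka}(u)b_{al}(v)-\sum_a b_{ka}(v)b_{al}(u)\Big)\end{aligned}$$ and $\sum_a b_{ia}(u)b_{aj}(-u)=\delta_{ij}$. For $\boldsymbol\mu(u)=(\mu_i(u))_i$ with $\mu_i(u)\in\varepsilon_i+u^{-1}\mathbb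 C[[u^{-1}]]$, the Verma module $M(\boldsymbol\mu(u))$ is the quotient of $\mathscr B_{\boldsymbol s,\boldsymbol\varepsilon}$ by the left ideal generated by all coefficients of $b_{ij}(u)$, $i<j$, and of $b_{ii}(u)-\mu_i(u)$; $V(\boldsymbol\mu(u))$ is its unique irreducible quotient, i.e. the quotient of $M(\boldsymbol\mu(u))$ by the sum of its proper submodules (it is $0$ if $M(\boldsymbol\mu(u))=0$). Put $\rho_k=\sum_{a=k}^{\varkappa}s_a$, $\varpi_k=\sum_{a=k}^{\varkappa}\varepsilon_as_a$ (both $0$ for $k=\varkappa+1$) and $\tilde\mu_i(u)=(2u-\rho_{i+1})\mu_i(u)+\sum_{a=i+1}^{\varkappa}s_a\mu_a(u)$. **Theorem.** Let $\boldsymbol\mu(u)$ be as above. Suppose that there are $\gamma\in\mathbb C$ and $\boldsymbol\lambda(u)$ as above such that $L(\boldsymbol\lambda(u))$ is finite-dimensional and, for all $1\le i<\varkappa$, $$\frac{\tilde\mu_i(u)}{\tilde\mu_{i+1}(u)}=\frac{(2\varepsilon_iu-\varepsilon_i\rho_{i+1}+\varpi_{i+1}+2\gamma)\,\lambda_i(u)\,\lambda_{i+1}(-u+\rho_{i+1})}{(2\varepsilon_{i+1}u-\varepsilon_{i+1}\rho_{i+2}+\varpi_{i+2}+2\gamma)\,\lambda_{i+1}(u)\,\lambda_i(-u+\rho_{i+1})}$$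 as formal Laurent series in $u^{-1}$. Then $V(\boldsymbol\mu(u))$ is finite-dimensional. -/

import Mathlib

noncomputable section

namespace SuperYangian

/-- The parity `|i| ∈ {0, 1}` attached to a sign `s i = (-1) ^ |i|`. -/
def parity (x : ℤˣ) : ℕ := if x = 1 then 0 else 1

/-- The coefficients, indexed by all integers `n`, of a series
`c0 + ∑_{r ≥ 1} x^{(r)} u^{-r}`: the entry at `n` is the coefficient of `u^{-n}`, and
`gen r` is `x^{(r + 1)}`. -/
def seriesCoeff {A : Type*} [Zero A] (c0 : A) (gen : ℕ → A) : ℤ → A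
  | Int.ofNat 0 => c0
  | Int.ofNat (r + 1) => gen r
  | Int.negSucc _ => 0

/-- The free algebra on letters `(i, j, r)`; the letter `(i, j, r)` stands for the generator with
matrix indices `i`, `j` and upper index `(r + 1)`. -/
abbrev Free (k : ℕ) : Type := FreeAlgebra ℂ (Fin k × Fin k × ℕ)

/-- The sign `(-1) ^ (|i||j| + |i||l| + |j||l|)`. -/
def sign3 {k : ℕ} (s : Fin k → ℤˣ) (i j l : Fin k) : ℂ :=
  (-1) ^ (parity (s i) * parity (s j) + parity (s i) * parity (s l) + parity (s j) * parity (s l))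

/-- The supercommutator `x y - (-1) ^ ((|i| + |j|) (|p| + |q|)) y x` of elements `x`, `y` of
parities `|i| + |j|` and `|p| + |q|`. -/
def superComm {k : ℕ} (s : Fin k → ℤˣ) (i j p q : Fin k) {A : Type*} [Ring A] [Algebra ℂ A]
    (x y : A) : A :=
  x * y - ((-1 : ℂ) ^ ((parity (s i) + parity (s j)) * (parity (s p) + parity (s q)))) • (y * x)

/-! ### The super Yangian -/

/-- The coefficient of `u^{-n}` in `t_{ij}(u) = δ_{ij} + ∑_{r ≥ 1} t_{ij}^{(r)} u^{-r}`, in the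
free algebra. -/
def tFree {k : ℕ} (i j : Fin k) (n : ℤ) : Free k :=
  seriesCoeff (if i = j then 1 else 0) (fun r => FreeAlgebra.ι ℂ (i, j, r)) n

/-- The defining relations of the super Yangian: the coefficients of `u^{-m} v^{-n}` in
`(u - v) [t_{ij}(u), t_{pq}(v)] = ± (t_{pj}(u) t_{iq}(v) - t_{pj}(v) t_{iq}(u))`. -/
inductive YRel {k : ℕ} (s : Fin k → ℤˣ) : Free k → Free k → Prop
  | comm (i j p q : Fin k) (m n : ℤ) : YRel s
      (superComm s i j p q (tFree i j (m + 1)) (tFree p q n)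
        - superComm s i j p q (tFree i j m) (tFree p q (n + 1)))
      (sign3 s i j p • (tFree p j m * tFree i q n - tFree p j n * tFree i q m))

/-- The super Yangian `Y(gl_{m|n}^s)` of the parity sequence `s`, of length `k = m + n`. -/
abbrev Y {k : ℕ} (s : Fin k → ℤˣ) : Type := RingQuot (YRel s)

/-- The coefficient of `u^{-n}` in the generating series `t_{ij}(u)` of the super Yangian. -/
def t {k : ℕ} (s : Fin k → ℤˣ) (i j : Fin k) (n : ℤ) : Y s :=
  RingQuot.mkAlgHom ℂ (YRel s) (tFree i j n)

/-- `ξ` is a highest `ℓ_s`-weight vector of highest `ℓ_s`-weight `lam`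
(in particular it generates `L`). A series in `u^{-1}` is a
power series in the variable `X = u^{-1}`. -/
structure IsHighestWeightVector {k : ℕ} (s : Fin k → ℤˣ) (lam : Fin k → PowerSeries ℂ)
    {L : Type*} [AddCommGroup L] [Module ℂ L] [Module (Y s) L] (ξ : L) : Prop where
  ne_zero : ξ ≠ 0
  generates : Submodule.span (Y s) {ξ} = ⊤
  upper : ∀ i j : Fin k, i < j → ∀ n : ℕ, t s i j n • ξ = 0
  diag : ∀ (i : Fin k) (n : ℕ), t s i i n • ξ = (PowerSeries.coeff n (lam i)) • ξ

/-- `L` is the irreducible highest `ℓ_s`-weight representation `L(lam)` of the super Yangian (which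
is unique up to isomorphism). -/
structure IsIrreducibleHighestWeight {k : ℕ} (s : Fin k → ℤˣ) (lam : Fin k → PowerSeries ℂ)
    (L : Type*) [AddCommGroup L] [Module ℂ L] [Module (Y s) L] : Prop where
  simple : IsSimpleModule (Y s) L
  exists_highest : ∃ ξ : L, IsHighestWeightVector s lam ξ

/-! ### The twisted super Yangian of type AIII -/

/-- The coefficient of `u^{-n}` in `b_{ij}(u) = δ_{ij} ε_i + ∑_{r ≥ 1} b_{ij}^{(r)} u^{-r}`, in the
free algebra. -/
def bFree {k : ℕ} (ε : Fin k → ℤˣ) (i j : Fin k) (n : ℤ) : Free k :=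
  seriesCoeff (if i = j then (((ε i : ℤ) : ℂ)) • (1 : Free k) else 0)
    (fun r => FreeAlgebra.ι ℂ (i, j, r)) n

/-- The coefficient of `u^{-m} v^{-n}` in `∑_a b_{ia}(u) b_{aj}(v)`. -/
def bbFree {k : ℕ} (ε : Fin k → ℤˣ) (i j : Fin k) (m n : ℤ) : Free k :=
  ∑ a : Fin k, bFree ε i a m * bFree ε a j n

/-- The coefficient of `u^{-m} v^{-n}` in `b_{pj}(u) b_{iq}(v) - b_{pj}(v) b_{iq}(u)`. -/
def bSkewFree {k : ℕ} (ε : Fin k → ℤˣ) (i j p q : Fin k) (m n : ℤ) : Free k :=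
  bFree ε p j m * bFree ε i q n - bFree ε p j n * bFree ε i q m

/-- The coefficient of `u^{-m} v^{-n}` in
`δ_{pj} ∑_a b_{ia}(u) b_{aq}(v) - δ_{iq} ∑_a b_{pa}(v) b_{aj}(u)`. -/
def bDeltaFree {k : ℕ} (ε : Fin k → ℤˣ) (i j p q : Fin k) (m n : ℤ) : Free k :=
  (if p = j then bbFree ε i q m n else 0) - (if i = q then bbFree ε p j n m else 0)

/-- The defining relations of the twisted super Yangian.
`reflection`: the coefficients of `u^{-m} v^{-n}` in the reflection relation multiplied by `u ^ 2 - v ^ 2`,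
```
(u² - v²) [b_{ij}(u), b_{pq}(v)] =
    ± (u + v) (b_{pj}(u) b_{iq}(v) - b_{pj}(v) b_{iq}(u))
  ± (u - v) (δ_{pj} ∑_a b_{ia}(u) b_{aq}(v) - δ_{iq} ∑_a b_{pa}(v) b_{aj}(u))
  - δ_{ij} (∑_a b_{pa}(u) b_{aq}(v) - ∑_a b_{pa}(v) b_{aq}(u)),
```
both signs being `(-1) ^ (|i||j| + |i||p| + |j||p|)`.
`unitary`: the coefficients of `u^{-n}` in `∑_a b_{ia}(u) b_{aj}(-u) = δ_{ij}`. -/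
inductive BRel {k : ℕ} (s ε : Fin k → ℤˣ) : Free k → Free k → Prop
  | reflection (i j p q : Fin k) (m n : ℤ) : BRel s ε
      (superComm s i j p q (bFree ε i j (m + 2)) (bFree ε p q n)
        - superComm s i j p q (bFree ε i j m) (bFree ε p q (n + 2)))
      (sign3 s i j p • (bSkewFree ε i j p q (m + 1) n + bSkewFree ε i j p q m (n + 1))
        + sign3 s i j p • (bDeltaFree ε i j p q (m + 1) n - bDeltaFree ε i j p q m (n + 1))
        - (if i = j then bbFree ε p q m n - bbFree ε p q n m else 0))
  | unitary (i j : Fin k) (n : ℕ) : BRel s ε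
      (∑ r ∈ Finset.range (n + 1), ((-1 : ℂ) ^ r) • bbFree ε i j ((n : ℤ) - r) r)
      (if i = j ∧ n = 0 then 1 else 0)

/-- The twisted super Yangian `B_{s,ε}` of type AIII. -/
abbrev B {k : ℕ} (s ε : Fin k → ℤˣ) : Type := RingQuot (BRel s ε)

/-- The coefficient of `u^{-n}` in the generating series `b_{ij}(u)` of the twisted super
Yangian. -/
def b {k : ℕ} (s ε : Fin k → ℤˣ) (i j : Fin k) (n : ℤ) : B s ε :=
  RingQuot.mkAlgHom ℂ (BRel s ε) (bFree ε i j n)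

/-- The left ideal generated by all coefficients of `b_{ij}(u)`, `i < j`, and of
`b_{ii}(u) - μ_i(u)`. -/
def vermaIdeal {k : ℕ} (s ε : Fin k → ℤˣ) (μ : Fin k → PowerSeries ℂ) :
    Submodule (B s ε) (B s ε) :=
  Submodule.span (B s ε)
    ({x | ∃ i j : Fin k, i < j ∧ ∃ n : ℕ, x = b s ε i j n} ∪
      {x | ∃ (i : Fin k) (n : ℕ),
        x = b s ε i i n - algebraMap ℂ (B s ε) (PowerSeries.coeff n (μ i))})

/-- The Verma module `M(μ)` of the twisted super Yangian. -/
abbrev Verma {k : ℕ} (s ε : Fin k → ℤˣ) (μ : Fin k → PowerSeries ℂ) : Type :=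
  B s ε ⧸ vermaIdeal s ε μ

/-- The sum of all proper submodules of the Verma module. When `M(μ) ≠ 0` it is the unique maximal
proper submodule, because all submodules are compatible with the weight decomposition and the
highest weight space is a line that generates `M(μ)`. -/
def vermaRadical {k : ℕ} (s ε : Fin k → ℤˣ) (μ : Fin k → PowerSeries ℂ) :
    Submodule (B s ε) (Verma s ε μ) :=
  sSup {N : Submodule (B s ε) (Verma s ε μ) | N ≠ ⊤}

/-- The unique irreducible quotient `V(μ)` of the Verma module `M(μ)` (it is zero if `M(μ)` is). -/
abbrev V {k : ℕ} (s ε : Fin k → ℤˣ) (μ : Fin k → PowerSeries ℂ) : Type :=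
  Verma s ε μ ⧸ vermaRadical s ε μ

/-! ### Series in `u^{-1}` -/

/-- `u`, as a formal Laurent series in `X = u^{-1}`. -/
def u : LaurentSeries ℂ := HahnSeries.single (-1 : ℤ) (1 : ℂ)

/-- A complex constant as a Laurent series. -/
def cst (c : ℂ) : LaurentSeries ℂ := HahnSeries.C c

/-- A power series in `X = u^{-1}`, seen as a Laurent series. -/
def toLaurent (f : PowerSeries ℂ) : LaurentSeries ℂ := HahnSeries.ofPowerSeries ℤ ℂ f

/-- The series `f(-u + c)`, expanded in `X = u^{-1}`: one substitutes
`(-u + c)⁻¹ = - X (1 - c X)⁻¹` for `X`. -/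
def reflectShift (c : ℂ) (f : PowerSeries ℂ) : PowerSeries ℂ :=
  PowerSeries.subst
    (-(PowerSeries.X * (1 - PowerSeries.C c * PowerSeries.X)⁻¹) : PowerSeries ℂ) f

/-- `∑_{a > i} s_a`, that is `ρ_{i+1}`. -/
def rhoSucc {k : ℕ} (s : Fin k → ℤˣ) (i : Fin k) : ℂ :=
  ∑ a ∈ Finset.univ.filter (fun a => i < a), ((s a : ℤ) : ℂ)

/-- `∑_{a > i} ε_a s_a`, that is `ϖ_{i+1}`. -/
def varpiSucc {k : ℕ} (s ε : Fin k → ℤˣ) (i : Fin k) : ℂ :=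
  ∑ a ∈ Finset.univ.filter (fun a => i < a), ((ε a : ℤ) : ℂ) * ((s a : ℤ) : ℂ)

/-- The series `(2 u - ρ_{i+1}) μ_i(u) + ∑_{a > i} s_a μ_a(u)`. -/
def muTilde {k : ℕ} (s : Fin k → ℤˣ) (μ : Fin k → PowerSeries ℂ) (i : Fin k) :
    LaurentSeries ℂ :=
  (2 * u - cst (rhoSucc s i)) * toLaurent (μ i)
    + ∑ a ∈ Finset.univ.filter (fun a => i < a), cst ((s a : ℤ) : ℂ) * toLaurent (μ a)

/-- The factor `2 ε_i u - ε_i ρ_{i+1} + ϖ_{i+1} + 2 γ`. -/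
def linFactor {k : ℕ} (s ε : Fin k → ℤˣ) (γ : ℂ) (i : Fin k) : LaurentSeries ℂ :=
  2 * cst ((ε i : ℤ) : ℂ) * u - cst (((ε i : ℤ) : ℂ) * rhoSucc s i) + cst (varpiSucc s ε i)
    + 2 * cst γ

end SuperYangian

end

/-!
If `T(u) = (t_{ij}(u))` and `K(u) = h(u) (E + γ u⁻¹)` with `E = diag(ε)`, then
`B(u) = T(u) K(u) T(-u)⁻¹` satisfies the reflection equation, and it is unitary when
`h(u) h(-u) (1 - γ² u⁻²) = 1`. Hence every module `L` over the super Yangian becomes a module over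
the twisted super Yangian (`exists_hom_dressed`).
If the highest weight vector `ξ` of `L` is also a highest weight vector
for `B(u)`, of weight `μ`, then its annihilator is a proper left ideal containing the one which
defines the Verma module, so `V(μ)` is a quotient of the submodule generated by `ξ` and hence
finite-dimensional (`finiteDimensional_of_highestWeightVector`). It remains to choose `h` such
that the weight of `ξ` is `μ`.

*Signs.* Putting the signs of the super tensor product into the entries of the matrix of `M ⊗ 1`
(`tensorLeft`) turns the defining relations of both algebras into identities between products of
ordinary matrices (`rtt_matrix`, `reflection_components`). The reflection equation for `B(u)` is
then the classical rearrangement of the `RTT` relations at `(±u, ±v)` (`reflection_dressed`),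
once it is known for the matrix `E + γ u⁻¹` (`reflection_involution`).

*Weights.* Series in `u⁻¹`, `v⁻¹` are handled as iterated power series, on which `u - v - r` is not
a zero divisor. The relation between `T(u)` and `S(v) = T(v)⁻¹` shows that `S(v)` is triangular
on `ξ` (`inv_upper`). Its diagonal entries satisfy `λ_i(u) s_{ii}(v) ξ ≡ λ_{i+1}(u) s_{i+1,i+1}(v) ξ`
modulo `u - v - ρ_{i+1}`, which at `u = v + ρ_{i+1}`, with `v` replaced by `-u`, is
`inv_diag_shift`. The diagonal entries `m_i(u, v)` of `T(u) K S(v)` on `ξ`, for a constant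
diagonal `K`, have the property that `(u - v - ρ_{i+1}) m_i + ∑_{a > i} s_a m_a` is an explicit
multiple of `λ_i(u) s_{ii}(v) ξ` (`dressed_diag`). For `v = -u` this is
`((2u - ρ_{i+1}) b_{ii}(u) + ∑_{a > i} s_a b_{aa}(u)) ξ =
h(u) (2 ε_i u - ε_i ρ_{i+1} + ϖ_{i+1} + 2γ) λ_i(u) s_{ii}(-u) ξ` (`dressed_diag_series`).
Dividing the formulas for `i` and `i + 1` gives exactly the quotients in the hypothesis, so
the weight of `ξ` is `μ` as soon as the last entry is right (`eq_smul_of_recursion`). The last entry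
prescribes `h` (`exists_scalar_series`), and the unitarity of this choice amounts to
`μ_ϰ(u) μ_ϰ(-u) = 1` for the last index `ϰ`. If this fails, the unitarity relation forces the Verma
module to vanish (`finiteDimensional_of_mul_negX_ne_one`).
-/

namespace SuperYangian

/-! ### Super tensor products as ordinary matrices -/

/-- The sign `(-1) ^ (|i||j|)`. -/
def chi {k : ℕ} (s : Fin k → ℤˣ) (i j : Fin k) : ℤ := (-1) ^ (parity (s i) * parity (s j))

theorem chi_comm {k : ℕ} (s : Fin k → ℤˣ) (i j : Fin k) : chi s i j = chi s j i := by
  simp [chi, mul_comm]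

theorem chi_mul_self {k : ℕ} (s : Fin k → ℤˣ) (i j : Fin k) : chi s i j * chi s i j = 1 := by
  rw [chi, ← mul_pow]; simp

theorem chi_self {k : ℕ} (s : Fin k → ℤˣ) (i : Fin k) : chi s i i = (s i : ℤ) := by
  rcases Int.units_eq_one_or (s i) with h | h <;> simp [chi, parity, h]

section Tensor

variable {k : ℕ} (s : Fin k → ℤˣ) {R : Type*} [Ring R]

/-- The matrix of `M ⊗ 1` on `ℂ^{m|n} ⊗ ℂ^{m|n}`, for an even matrix `M` with entries in a
superalgebra. The signs which come from moving the entries of `M` past the basis vectors of the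
second factor are put into the entries, so that products of such matrices in the super sense are
ordinary matrix products. -/
def tensorLeft (M : Matrix (Fin k) (Fin k) R) :
    Matrix (Fin k × Fin k) (Fin k × Fin k) R :=
  fun x y => if x.2 = y.2 then (chi s x.2 x.1 * chi s x.2 y.1) • M x.1 y.1 else 0

/-- The matrix of `1 ⊗ M` on `ℂ^{m|n} ⊗ ℂ^{m|n}`; with the convention of `tensorLeft`, it has no
signs. -/
def tensorRight (M : Matrix (Fin k) (Fin k) R) :
    Matrix (Fin k × Fin k) (Fin k × Fin k) R :=
  fun x y => if x.1 = y.1 then M x.2 y.2 else 0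

variable (R) in
/-- The super flip `e_j ⊗ e_l ↦ (-1) ^ (|j||l|) e_l ⊗ e_j`. -/
def superSwap : Matrix (Fin k × Fin k) (Fin k × Fin k) R :=
  fun x y => if x = y.swap then ((chi s x.1 x.2 : ℤ) : R) else 0

theorem superSwap_mul_apply (M : Matrix (Fin k × Fin k) (Fin k × Fin k) R) (i p : Fin k)
    (y : Fin k × Fin k) : (superSwap s R * M) (i, p) y = chi s i p • M (p, i) y := by
  rw [Matrix.mul_apply, Finset.sum_eq_single (p, i)]
  · simp [superSwap, zsmul_eq_mul]
  · rintro ⟨a, b⟩ - h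
    rw [superSwap, if_neg, zero_mul]
    rintro h'
    simp only [Prod.swap_prod_mk, Prod.mk.injEq] at h'
    exact h (by rw [h'.1, h'.2])
  · simp

theorem mul_superSwap_apply (M : Matrix (Fin k × Fin k) (Fin k × Fin k) R) (x : Fin k × Fin k)
    (j q : Fin k) : (M * superSwap s R) x (j, q) = chi s j q • M x (q, j) := by
  rw [Matrix.mul_apply, Finset.sum_eq_single (q, j)]
  · simp [superSwap, zsmul_eq_mul, chi_comm s j q, (Int.cast_commute _ _).eq]
  · rintro ⟨a, b⟩ - h
    rw [superSwap, if_neg, mul_zero]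
    rintro h'
    exact h h'
  · simp

theorem superSwap_mul_self : superSwap s R * superSwap s R = 1 := by
  ext ⟨i, p⟩ ⟨j, q⟩
  rw [superSwap_mul_apply, superSwap]
  by_cases h : i = j ∧ p = q
  · obtain ⟨rfl, rfl⟩ := h
    simp only [Prod.swap_prod_mk, if_true, Matrix.one_apply_eq]
    rw [zsmul_eq_mul, ← Int.cast_mul, chi_comm s p i, chi_mul_self, Int.cast_one]
  · rw [if_neg (by simpa [and_comm] using h), smul_zero, Matrix.one_apply_ne]
    simpa using h

theorem tensorLeft_mul_apply (M : Matrix (Fin k) (Fin k) R)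
    (N : Matrix (Fin k × Fin k) (Fin k × Fin k) R) (i p : Fin k) (y : Fin k × Fin k) :
    (tensorLeft s M * N) (i, p) y = ∑ a, (chi s p i * chi s p a) • (M i a * N (a, p) y) := by
  rw [Matrix.mul_apply, Fintype.sum_prod_type]
  refine Finset.sum_congr rfl fun a _ => ?_
  rw [Finset.sum_eq_single p] <;> simp +contextual [tensorLeft, eq_comm, mul_assoc]

theorem tensorRight_mul_apply (M : Matrix (Fin k) (Fin k) R)
    (N : Matrix (Fin k × Fin k) (Fin k × Fin k) R) (i p : Fin k) (y : Fin k × Fin k) :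
    (tensorRight M * N) (i, p) y = ∑ a, M p a * N (i, a) y := by
  rw [Matrix.mul_apply, Fintype.sum_prod_type, Finset.sum_eq_single i] <;>
    simp +contextual [tensorRight, eq_comm]

theorem tensorLeft_mul (M N : Matrix (Fin k) (Fin k) R) :
    tensorLeft s (M * N) = tensorLeft s M * tensorLeft s N := by
  ext ⟨i, p⟩ ⟨j, q⟩
  rw [tensorLeft_mul_apply]
  by_cases h : p = q
  · subst h
    simp only [tensorLeft, if_true, Matrix.mul_apply, Finset.smul_sum]
    refine Finset.sum_congr rfl fun a _ => ?_
    rw [mul_smul_comm, smul_smul]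
    congr 1
    linear_combination (-chi s p i * chi s p j) * chi_mul_self s p a
  · simp [tensorLeft, h]

theorem tensorLeft_one : tensorLeft s (1 : Matrix (Fin k) (Fin k) R) = 1 := by
  ext ⟨i, p⟩ ⟨j, q⟩
  by_cases h : p = q <;> by_cases h' : i = j <;>
    simp [tensorLeft, h, h', Matrix.one_apply, chi_mul_self]

theorem superSwap_mul_tensorLeft (M : Matrix (Fin k) (Fin k) R) :
    superSwap s R * tensorLeft s M = tensorRight M * superSwap s R := by
  ext ⟨i, p⟩ ⟨j, q⟩
  rw [superSwap_mul_apply, mul_superSwap_apply]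
  by_cases h : i = q
  · subst h
    simp only [tensorLeft, tensorRight, if_true, smul_smul]
    congr 1
    rw [chi_comm s j i]
    linear_combination (chi s i j) * chi_mul_self s i p
  · simp [tensorLeft, tensorRight, h]

theorem superSwap_mul_tensorRight (M : Matrix (Fin k) (Fin k) R) :
    superSwap s R * tensorRight M = tensorLeft s M * superSwap s R := by
  have h := congrArg (fun N => superSwap s R * N * superSwap s R) (superSwap_mul_tensorLeft s M)
  simp only [← mul_assoc, superSwap_mul_self, one_mul] at h
  rw [h, mul_assoc, superSwap_mul_self, mul_one]

theorem tensorRight_eq (M : Matrix (Fin k) (Fin k) R) :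
    tensorRight M = superSwap s R * tensorLeft s M * superSwap s R := by
  rw [superSwap_mul_tensorLeft, mul_assoc, superSwap_mul_self, mul_one]

theorem tensorRight_mul (M N : Matrix (Fin k) (Fin k) R) :
    tensorRight (M * N) = tensorRight M * tensorRight N := by
  ext ⟨i, p⟩ ⟨j, q⟩
  rw [tensorRight_mul_apply]
  by_cases h : i = j <;> simp [tensorRight, h, Matrix.mul_apply]

theorem tensorRight_one : tensorRight (1 : Matrix (Fin k) (Fin k) R) = 1 := by
  ext ⟨i, p⟩ ⟨j, q⟩
  by_cases h : p = q <;> by_cases h' : i = j <;> simp [tensorRight, h, h', Matrix.one_apply]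

theorem tensorLeft_mul_tensorRight_apply (M N : Matrix (Fin k) (Fin k) R) (i p j q : Fin k) :
    (tensorLeft s M * tensorRight N) (i, p) (j, q) =
      (chi s p i * chi s p j) • (M i j * N p q) := by
  rw [tensorLeft_mul_apply, Finset.sum_eq_single j] <;> simp +contextual [tensorRight]

theorem tensorRight_mul_tensorLeft_apply (M N : Matrix (Fin k) (Fin k) R) (i p j q : Fin k) :
    (tensorRight N * tensorLeft s M) (i, p) (j, q) =
      (chi s q i * chi s q j) • (N p q * M i j) := by
  rw [tensorRight_mul_apply, Finset.sum_eq_single q] <;>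
    simp +contextual [tensorLeft, -zsmul_eq_mul]

end Tensor

section Components

variable {k : ℕ} (s : Fin k → ℤˣ) {Z R : Type*} [CommRing Z] [Ring R] [Algebra Z R]

/-- The integer sign in the supercommutator of elements of parities `|i| + |j|`, `|p| + |q|`. -/
def commSign (i j p q : Fin k) : ℤ := chi s i p * chi s i q * chi s j p * chi s j q

/-- The integer sign `(-1) ^ (|i||j| + |i||p| + |j||p|)`. -/
def tripleSign (i j p : Fin k) : ℤ := chi s i j * chi s i p * chi s j p

/-- The `R`-matrix form of the relation
`d [T_{ij}, T'_{pq}] = ± c (T_{pj} T'_{iq} - T'_{pj} T_{iq})`. -/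
theorem rtt_matrix {T T' : Matrix (Fin k) (Fin k) R} {d c : Z}
    (h : ∀ i j p q, d • (T i j * T' p q - commSign s i j p q • (T' p q * T i j)) =
      c • tripleSign s i j p • (T p j * T' i q - T' p j * T i q)) :
    (d • 1 - c • superSwap s R) * tensorLeft s T * tensorRight T' =
      tensorRight T' * tensorLeft s T * (d • 1 - c • superSwap s R) := by
  simp only [sub_mul, mul_sub, smul_mul_assoc, mul_smul_comm, one_mul, mul_one]
  rw [sub_eq_sub_iff_sub_eq_sub]
  ext ⟨i, p⟩ ⟨j, q⟩
  rw [mul_assoc (superSwap s R)]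
  simp only [Matrix.sub_apply, Matrix.smul_apply, superSwap_mul_apply, mul_superSwap_apply,
    tensorLeft_mul_tensorRight_apply, tensorRight_mul_tensorLeft_apply]
  have h := h i j p q
  revert h
  -- only the four signs matter: each choice turns the goal into the hypothesis, up to a sign
  simp only [commSign, tripleSign, chi]
  rcases Int.units_eq_one_or (s i) with h1 | h1 <;>
  rcases Int.units_eq_one_or (s j) with h2 | h2 <;>
  rcases Int.units_eq_one_or (s p) with h3 | h3 <;>
  rcases Int.units_eq_one_or (s q) with h4 | h4 <;>
  simp only [h1, h2, h3, h4, parity] <;> norm_num <;> intro h <;>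
  first
    | linear_combination (norm := module) h
    | linear_combination (norm := module) -h

/-- The componentwise form of the relation
`d [T ⊗ 1, 1 ⊗ S] = c ((T ⊗ 1) P (1 ⊗ S) - (1 ⊗ S) P (T ⊗ 1))`. -/
theorem mixed_components {T S : Matrix (Fin k) (Fin k) R} {d c : Z}
    (h : d • (tensorLeft s T * tensorRight S - tensorRight S * tensorLeft s T) =
      c • (tensorLeft s T * superSwap s R * tensorRight S -
        tensorRight S * superSwap s R * tensorLeft s T)) (i j p q : Fin k) :
    d • (T i j * S p q - commSign s i j p q • (S p q * T i j)) =
      c • tripleSign s i j p •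
        ((if p = j then (T * S) i q else 0) - (if i = q then (S * T) p j else 0)) := by
  rw [mul_assoc _ (superSwap s R), superSwap_mul_tensorRight, ← superSwap_mul_tensorLeft,
    mul_assoc (superSwap s R), ← mul_assoc, ← tensorLeft_mul, ← tensorLeft_mul] at h
  have h := congrFun (congrFun h (i, p)) (j, q)
  simp only [Matrix.sub_apply, Matrix.smul_apply, superSwap_mul_apply, mul_superSwap_apply,
    tensorLeft_mul_tensorRight_apply, tensorRight_mul_tensorLeft_apply, tensorLeft] at h
  -- the `if`s are kept as atoms; where they do not vanish, they identify some of the signs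
  have key : ∀ (P : Prop) [Decidable P] (z : ℤ) (w : R),
      (if P then z • w else 0) = z • (if P then w else 0) := by
    intro P _ z w; split_ifs <;> simp
  simp only [key] at h
  have hpj : s p = s j ∨ (if p = j then (T * S) i q else 0) = 0 := by
    by_cases hpj : p = j <;> simp [hpj]
  have hiq : s i = s q ∨ (if i = q then (S * T) p j else 0) = 0 := by
    by_cases hiq : i = q <;> simp [hiq]
  revert h hpj hiq
  generalize (if p = j then (T * S) i q else 0) = x
  generalize (if i = q then (S * T) p j else 0) = y
  simp only [commSign, tripleSign, chi]
  rcases Int.units_eq_one_or (s i) with h1 | h1 <;>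
  rcases Int.units_eq_one_or (s j) with h2 | h2 <;>
  rcases Int.units_eq_one_or (s p) with h3 | h3 <;>
  rcases Int.units_eq_one_or (s q) with h4 | h4 <;>
  simp only [h1, h2, h3, h4, parity] <;> norm_num <;> intro h <;> intros <;> subst_vars <;>
  first
    | linear_combination (norm := module) h
    | linear_combination (norm := module) -h

/-- The componentwise form of the reflection equation. -/
theorem reflection_components {B B' : Matrix (Fin k) (Fin k) R} {d d' c : Z}
    (h : (d • 1 - c • superSwap s R) * tensorLeft s B * (d' • 1 - c • superSwap s R) *
        tensorRight B' =
      tensorRight B' * (d' • 1 - c • superSwap s R) * tensorLeft s B *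
        (d • 1 - c • superSwap s R)) (i j p q : Fin k) :
    (d * d') • (B i j * B' p q - commSign s i j p q • (B' p q * B i j)) =
      (c * d') • tripleSign s i j p • (B p j * B' i q - B' p j * B i q) +
      (c * d) • tripleSign s i j p •
        ((if p = j then (B * B') i q else 0) - (if i = q then (B' * B) p j else 0)) -
      (c * c) • (if i = j then (B * B') p q - (B' * B) p q else 0) := by
  have h1 : tensorLeft s B * superSwap s R * tensorRight B' =
      tensorLeft s (B * B') * superSwap s R := by
    rw [mul_assoc _ (superSwap s R), superSwap_mul_tensorRight, ← mul_assoc, ← tensorLeft_mul]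
  have h2 : tensorRight B' * superSwap s R * tensorLeft s B =
      superSwap s R * tensorLeft s (B' * B) := by
    rw [← superSwap_mul_tensorLeft, mul_assoc (superSwap s R), ← tensorLeft_mul]
  have h3 : superSwap s R * (tensorLeft s B * superSwap s R * tensorRight B') =
      tensorRight (B * B') := by
    rw [h1, ← mul_assoc, tensorRight_eq]
  have h4 : tensorRight B' * superSwap s R * tensorLeft s B * superSwap s R =
      tensorRight (B' * B) := by
    rw [h2, tensorRight_eq]
  have h : (d * d') • (tensorLeft s B * tensorRight B' - tensorRight B' * tensorLeft s B) =
      (c * d') • (superSwap s R * (tensorLeft s B * tensorRight B') -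
        tensorRight B' * tensorLeft s B * superSwap s R) +
      (c * d) • (tensorLeft s (B * B') * superSwap s R - superSwap s R * tensorLeft s (B' * B)) -
      (c * c) • (tensorRight (B * B') - tensorRight (B' * B)) := by
    rw [← h3, ← h4, ← h1, ← h2]
    simp only [sub_mul, mul_sub, smul_mul_assoc, mul_smul_comm, one_mul, mul_one,
      mul_assoc] at h ⊢
    linear_combination (norm := module) h
  have h := congrFun (congrFun h (i, p)) (j, q)
  simp only [Matrix.sub_apply, Matrix.add_apply, Matrix.smul_apply, superSwap_mul_apply,
    mul_superSwap_apply, tensorLeft_mul_tensorRight_apply, tensorRight_mul_tensorLeft_apply,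
    tensorLeft, tensorRight] at h
  have key : ∀ (P : Prop) [Decidable P] (z : ℤ) (w : R),
      (if P then z • w else 0) = z • (if P then w else 0) := by
    intro P _ z w; split_ifs <;> simp
  have key' : ∀ (P : Prop) [Decidable P] (v w : R),
      (if P then v else 0) - (if P then w else 0) = if P then v - w else 0 := by
    intro P _ v w; split_ifs <;> simp
  simp only [key, key'] at h
  have hpj : s p = s j ∨ (if p = j then (B * B') i q else 0) = 0 := by
    by_cases hpj : p = j <;> simp [hpj]
  have hiq : s i = s q ∨ (if i = q then (B' * B) p j else 0) = 0 := by
    by_cases hiq : i = q <;> simp [hiq]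
  have hij : s i = s j ∨ (if i = j then (B * B') p q - (B' * B) p q else 0) = 0 := by
    by_cases hij : i = j <;> simp [hij]
  revert h hpj hiq hij
  generalize (if p = j then (B * B') i q else 0) = x
  generalize (if i = q then (B' * B) p j else 0) = y
  generalize (if i = j then (B * B') p q - (B' * B) p q else 0) = z
  clear h1 h2 h3 h4
  simp only [commSign, tripleSign, chi]
  rcases Int.units_eq_one_or (s i) with h1 | h1 <;>
  rcases Int.units_eq_one_or (s j) with h2 | h2 <;>
  rcases Int.units_eq_one_or (s p) with h3 | h3 <;>
  rcases Int.units_eq_one_or (s q) with h4 | h4 <;>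
  simp only [h1, h2, h3, h4, parity] <;> norm_num <;> intro h <;> intros <;> subst_vars <;>
  first
    | linear_combination (norm := module) h
    | linear_combination (norm := module) -h

end Components

/-! ### Dressed solutions of the reflection equation -/

section Dressing

variable {Z M : Type*} [CommRing Z] [Ring M] [Algebra Z M]

/-- `E + γ x`, with `E² = 1`, solves the reflection equation. Here `E₁ = E ⊗ 1`, `E₂ = 1 ⊗ E`
and `x = u⁻¹`, `y = v⁻¹`. -/
theorem reflection_involution {P E₁ E₂ : M} {d d' c x y g : Z}
    (hd : d = y - x) (hd' : d' = y + x) (hc : c = x * y)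
    (hPP : P * P = 1) (hP₁ : P * E₁ = E₂ * P) (hP₂ : P * E₂ = E₁ * P)
    (hE₁ : E₁ * E₁ = 1) (hE₂ : E₂ * E₂ = 1) (hE : E₂ * E₁ = E₁ * E₂) :
    (d • 1 - c • P) * (E₁ + (g * x) • 1) * (d' • 1 - c • P) * (E₂ + (g * y) • 1) =
      (E₂ + (g * y) • 1) * (d' • 1 - c • P) * (E₁ + (g * x) • 1) * (d • 1 - c • P) := by
  have a4 : ∀ z, E₁ * (E₁ * z) = z := fun z => by rw [← mul_assoc, hE₁, one_mul]
  have a5 : ∀ z, E₂ * (E₂ * z) = z := fun z => by rw [← mul_assoc, hE₂, one_mul]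
  have a6 : ∀ z, E₂ * (E₁ * z) = E₁ * (E₂ * z) := fun z => by rw [← mul_assoc, hE, mul_assoc]
  simp only [mul_add, add_mul, mul_sub, sub_mul, smul_mul_assoc, mul_smul_comm, one_mul, mul_one,
    mul_assoc, hPP, hP₁, hP₂, hE₂, hE, a4, a5, a6]
  subst hd hd' hc
  module

/-- If `X = T(u)`, `X' = T(-u)`, `W = T(v)`, `W' = T(-v)` satisfy the `RTT` relations and `K₁`,
`K₂` solve the reflection equation, then so do `T(u) K(u) T(-u)⁻¹` and `T(v) K(v) T(-v)⁻¹`. -/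
theorem reflection_dressed {R R' X₁ X₁' Y₁' W₂ W₂' V₂' K₁ K₂ : M}
    (h1 : R * X₁ * W₂ = W₂ * X₁ * R) (h2 : R' * X₁ * W₂' = W₂' * X₁ * R')
    (h3 : R' * W₂ * X₁' = X₁' * W₂ * R') (h4 : R * W₂' * X₁' = X₁' * W₂' * R)
    (hY : X₁' * Y₁' = 1) (hY' : Y₁' * X₁' = 1) (hV : W₂' * V₂' = 1) (hV' : V₂' * W₂' = 1)
    (hK : R * K₁ * R' * K₂ = K₂ * R' * K₁ * R)
    (hKW : K₁ * W₂ = W₂ * K₁) (hKY : Y₁' * K₂ = K₂ * Y₁') (hKX : X₁ * K₂ = K₂ * X₁)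
    (hKV : K₁ * V₂' = V₂' * K₁) :
    R * (X₁ * K₁ * Y₁') * R' * (W₂ * K₂ * V₂') = (W₂ * K₂ * V₂') * R' * (X₁ * K₁ * Y₁') * R := by
  have h2' : X₁ * R' * V₂' = V₂' * R' * X₁ := by
    calc X₁ * R' * V₂' = V₂' * (W₂' * X₁ * R') * V₂' := by
          simp only [← mul_assoc, hV', one_mul]
      _ = V₂' * R' * X₁ := by rw [← h2]; simp only [mul_assoc, hV, mul_one]
  have h3' : Y₁' * R' * W₂ = W₂ * R' * Y₁' := by
    calc Y₁' * R' * W₂ = Y₁' * (R' * W₂ * X₁') * Y₁' := by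
          simp only [mul_assoc, hY, mul_one]
      _ = W₂ * R' * Y₁' := by rw [h3]; simp only [← mul_assoc, hY', one_mul]
  have h4' : R * Y₁' * V₂' = V₂' * Y₁' * R := by
    calc R * Y₁' * V₂' = V₂' * Y₁' * (X₁' * W₂' * R) * Y₁' * V₂' := by
          have : V₂' * Y₁' * (X₁' * W₂' * R) = V₂' * (Y₁' * X₁') * W₂' * R := by
            simp only [mul_assoc]
          rw [this, hY', mul_one, hV', one_mul]
      _ = V₂' * Y₁' * R * (W₂' * (X₁' * Y₁') * V₂') := by rw [← h4]; simp only [mul_assoc]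
      _ = V₂' * Y₁' * R := by rw [hY, mul_one, hV, mul_one]
  calc R * (X₁ * K₁ * Y₁') * R' * (W₂ * K₂ * V₂')
      = R * X₁ * K₁ * (Y₁' * R' * W₂) * K₂ * V₂' := by simp only [mul_assoc]
    _ = R * X₁ * (K₁ * W₂) * R' * (Y₁' * K₂) * V₂' := by rw [h3']; simp only [mul_assoc]
    _ = (R * X₁ * W₂) * K₁ * R' * K₂ * Y₁' * V₂' := by rw [hKW, hKY]; simp only [mul_assoc]
    _ = W₂ * X₁ * (R * K₁ * R' * K₂) * Y₁' * V₂' := by rw [h1]; simp only [mul_assoc]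
    _ = W₂ * (X₁ * K₂) * R' * K₁ * (R * Y₁' * V₂') := by rw [hK]; simp only [mul_assoc]
    _ = W₂ * K₂ * X₁ * R' * (K₁ * V₂') * Y₁' * R := by rw [hKX, h4']; simp only [mul_assoc]
    _ = W₂ * K₂ * (X₁ * R' * V₂') * K₁ * Y₁' * R := by rw [hKV]; simp only [mul_assoc]
    _ = (W₂ * K₂ * V₂') * R' * (X₁ * K₁ * Y₁') * R := by rw [h2']; simp only [mul_assoc]

/-- The relation between `T(u)` and `T(v)⁻¹`. -/
theorem mixed_of_rtt {P X₁ W₂ V₂ : M} {d c : Z}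
    (h : (d • 1 - c • P) * X₁ * W₂ = W₂ * X₁ * (d • 1 - c • P))
    (hV : W₂ * V₂ = 1) (hV' : V₂ * W₂ = 1) :
    d • (X₁ * V₂ - V₂ * X₁) = c • (X₁ * P * V₂ - V₂ * P * X₁) := by
  have h' : V₂ * (d • 1 - c • P) * X₁ = X₁ * (d • 1 - c • P) * V₂ := by
    calc V₂ * (d • 1 - c • P) * X₁ = V₂ * ((d • 1 - c • P) * X₁ * W₂) * V₂ := by
          simp only [mul_assoc, hV, mul_one]
      _ = X₁ * (d • 1 - c • P) * V₂ := by rw [h]; simp only [← mul_assoc, hV', one_mul]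
  simp only [mul_sub, sub_mul, smul_mul_assoc, mul_smul_comm, mul_one] at h'
  linear_combination (norm := module) -h'

end Dressing

/-! ### Highest weight vectors of solutions of the `RTT` relation -/

section HighestWeight

/-- `∑_{a > i} s_a`, as an integer. -/
def rhoInt {k : ℕ} (s : Fin k → ℤˣ) (i : Fin k) : ℤ := ∑ a ∈ Finset.Ioi i, (s a : ℤ)

theorem rhoInt_def {k : ℕ} (s : Fin k → ℤˣ) (i : Fin k) :
    rhoInt s i = ∑ a ∈ Finset.Ioi i, (s a : ℤ) := rfl

theorem sum_eq_add_sum_Ioi {k : ℕ} {R : Type*} [AddCommMonoid R] (f : Fin k → R) (j : Fin k)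
    (h : ∀ a < j, f a = 0) : ∑ a, f a = f j + ∑ a ∈ Finset.Ioi j, f a := by
  rw [← Finset.sum_insert (by simp)]
  symm
  refine Finset.sum_subset (Finset.subset_univ _) fun a _ ha => h a ?_
  simp only [Finset.mem_insert, Finset.mem_Ioi, not_or, not_lt] at ha
  exact lt_of_le_of_ne ha.2 ha.1

theorem commSign_mul_tripleSign {k : ℕ} (s : Fin k → ℤˣ) (a j i : Fin k) :
    commSign s a j i a * tripleSign s a j i = (s a : ℤ) := by
  rw [← chi_self, commSign, tripleSign, chi_comm s j a, chi_comm s j i]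
  linear_combination chi s a a * chi s i j * chi s i j * chi s a j * chi s a j *
    chi_mul_self s a i + chi s a a * chi s i j * chi s i j * chi_mul_self s a j
    + chi s a a * chi_mul_self s i j

theorem commSign_mul_self {k : ℕ} (s : Fin k → ℤˣ) (i j p q : Fin k) :
    commSign s i j p q * commSign s i j p q = 1 := by
  have : commSign s i j p q * commSign s i j p q = (chi s i p * chi s i p) *
    (chi s i q * chi s i q) * (chi s j p * chi s j p) * (chi s j q * chi s j q) := by
    rw [commSign]; ring
  rw [this]
  simp [chi_mul_self]

/-!
The lemmas of this section are applied to `T = T(u)`, `T' = T(v)`, `S = T(v)⁻¹`, with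
`d = v⁻¹ - u⁻¹` and `c = u⁻¹ v⁻¹`, so that `u - v = d / c`. The series `l i` is the highest weight
`λ_i(u)`, and right multiplication by `e` stands for the evaluation at a highest weight vector.
-/

variable {k : ℕ} {s : Fin k → ℤˣ} {Z R : Type*} [CommRing Z] [Ring R] [Algebra Z R]
  {T S : Matrix (Fin k) (Fin k) R} {e : R} {c d : Z} {l : Fin k → Z}

theorem smul_lower_mul_upper
    (hmix : ∀ i j p q, d • (T i j * S p q - commSign s i j p q • (S p q * T i j)) =
      c • tripleSign s i j p •
        ((if p = j then (T * S) i q else 0) - (if i = q then (S * T) p j else 0)))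
    {i a : Fin k} (hSe : S i a * e = 0) (j : Fin k) :
    d • (S i a * T a j * e) = (c * ((s a : ℤ) : Z)) •
      ((S * T) i j * e - if i = j then (T * S) a a * e else 0) := by
  have h := congrArg (fun f => commSign s a j i a • (f * e)) (hmix a j i a)
  simp only [if_true, smul_mul_assoc, sub_mul, mul_assoc, hSe, mul_zero, ite_mul, zero_mul,
    zero_sub, smul_neg] at h
  rw [smul_comm _ d, smul_smul, commSign_mul_self, one_smul, smul_comm _ c,
    smul_smul (commSign _ _ _ _ _), commSign_mul_tripleSign] at h
  simp only [mul_assoc]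
  rw [mul_smul, Int.cast_smul_eq_zsmul]
  linear_combination (norm := module) -h

theorem smul_upper_mul_lower
    (hmix : ∀ i j p q, d • (T i j * S p q - commSign s i j p q • (S p q * T i j)) =
      c • tripleSign s i j p •
        ((if p = j then (T * S) i q else 0) - (if i = q then (S * T) p j else 0)))
    {i a : Fin k} (hTe : T i a * e = 0) (j : Fin k) :
    d • (T i a * S a j * e) = (c * ((s a : ℤ) : Z)) •
      ((T * S) i j * e - if i = j then (S * T) a a * e else 0) := by
  have h := congrArg (fun f => f * e) (hmix i a a j)
  have h2 : tripleSign s i a a = (s a : ℤ) := by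
    rw [← chi_self, tripleSign, chi_mul_self, one_mul]
  simp only [if_true, smul_mul_assoc, sub_mul, mul_assoc, hTe, mul_zero, ite_mul, zero_mul,
    smul_zero, sub_zero, h2] at h
  simp only [mul_assoc]
  rw [mul_smul, Int.cast_smul_eq_zsmul]
  exact h

variable (hmix : ∀ i j p q, d • (T i j * S p q - commSign s i j p q • (S p q * T i j)) =
      c • tripleSign s i j p •
        ((if p = j then (T * S) i q else 0) - (if i = q then (S * T) p j else 0)))
  (htor : ∀ (r : ℤ) (f : R), (d - r * c) • f = 0 → f = 0)
  (hup : ∀ i j, i < j → T i j * e = 0) (hdiag : ∀ i, T i i * e = l i • e)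
  {T' τ : Matrix (Fin k) (Fin k) R} (hST : S * T' = 1) (hT : T = T' + d • τ)

include hST hT in
/-- At `v = u` the product `S(v) T(u)` is the identity, so that the difference to it is divisible
by `u - v`. -/
theorem inv_mul_eq (i j : Fin k) :
    (S * T) i j * e = (if i = j then e else 0) + d • ((S * τ) i j * e) := by
  rw [hT, mul_add, hST, Matrix.add_apply, add_mul, Matrix.mul_smul, Matrix.smul_apply,
    smul_mul_assoc, Matrix.one_apply]
  split_ifs <;> simp

include hmix htor hup hdiag hST hT in
/-- The product of `λ_j(u)` with the entry `(i, j)` of `T(v)⁻¹`, `i < j`, is divisible by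
`u - v - ρ_{j+1}` on a highest weight vector. -/
theorem exists_smul_inv_upper {i j : Fin k} (hij : i < j)
    (ih : ∀ a, j < a → S i a * e = 0) :
    ∃ f : R, l j • (S i j * e) = (d - rhoInt s j * c) • f := by
  refine ⟨(S * τ) i j * e, ?_⟩
  have hD := inv_mul_eq (e := e) hST hT i j
  rw [if_neg hij.ne, zero_add] at hD
  have hsum : (S * T) i j * e = l j • (S i j * e) + ∑ a ∈ Finset.Ioi j, S i a * T a j * e := by
    rw [Matrix.mul_apply, Finset.sum_mul, sum_eq_add_sum_Ioi _ j, mul_assoc, hdiag, mul_smul_comm]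
    intro a ha
    rw [mul_assoc, hup a j ha, mul_zero]
  have h2 : d • (S * T) i j * e = d • l j • (S i j * e) +
      (c * (rhoInt s j : Z)) • ((S * T) i j * e) := by
    rw [smul_mul_assoc, hsum, smul_add, ← hsum, Finset.smul_sum, rhoInt, Int.cast_sum,
      Finset.mul_sum, Finset.sum_smul]
    congr 1
    refine Finset.sum_congr rfl fun a ha => ?_
    rw [smul_lower_mul_upper hmix (ih a (Finset.mem_Ioi.1 ha)), if_neg hij.ne, sub_zero]
  rw [smul_mul_assoc, hD] at h2
  rw [← sub_eq_zero]
  apply htor 0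
  linear_combination (norm := (push_cast; module)) -h2

variable (hlow : ∀ i j, i < j → S i j * e = 0)

include hup hdiag in
theorem inv_mul_apply_mul (i : Fin k) :
    (S * T) i i * e = l i • (S i i * e) + ∑ a ∈ Finset.Ioi i, S i a * T a i * e := by
  rw [Matrix.mul_apply, Finset.sum_mul, sum_eq_add_sum_Ioi _ i, mul_assoc, hdiag, mul_smul_comm]
  intro a ha
  rw [mul_assoc, hup a i ha, mul_zero]

include hlow in
theorem mul_inv_apply_mul (i : Fin k) :
    (T * S) i i * e = T i i * S i i * e + ∑ a ∈ Finset.Ioi i, T i a * S a i * e := by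
  rw [Matrix.mul_apply, Finset.sum_mul, sum_eq_add_sum_Ioi _ i]
  intro a ha
  rw [mul_assoc, hlow a i ha, mul_zero]

include hmix in
theorem smul_diag_comm (i : Fin k) : d • (T i i * S i i * e) = d • (S i i * T i i * e) +
    (c * ((s i : ℤ) : Z)) • ((T * S) i i * e - (S * T) i i * e) := by
  have h := congrArg (fun f => f * e) (hmix i i i i)
  have h2 : tripleSign s i i i = (s i : ℤ) := by
    rw [← chi_self, tripleSign, chi_mul_self, one_mul]
  have h3 : commSign s i i i i = 1 := by
    rw [commSign, chi_mul_self, one_mul, chi_mul_self]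
  simp only [if_true, smul_mul_assoc, sub_mul, h2, h3, one_smul] at h
  rw [mul_smul, Int.cast_smul_eq_zsmul]
  linear_combination (norm := module) h

include hmix htor hup hdiag hlow in
/-- `T(u) T(v)⁻¹` and `T(v)⁻¹ T(u)` have the same diagonal entries on a highest weight vector. -/
theorem mul_inv_apply_eq (i : Fin k) : (T * S) i i * e = (S * T) i i * e := by
  induction i using WellFoundedGT.induction with
  | ind i ih =>
  have h1 : d • ((T * S) i i * e) = d • (T i i * S i i * e) +
      ∑ a ∈ Finset.Ioi i, (c * ((s a : ℤ) : Z)) • ((T * S) i i * e - (S * T) a a * e) := by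
    rw [mul_inv_apply_mul hlow, smul_add, ← mul_inv_apply_mul hlow, Finset.smul_sum]
    congr 1
    refine Finset.sum_congr rfl fun a ha => ?_
    rw [smul_upper_mul_lower hmix (hup i a (Finset.mem_Ioi.1 ha)), if_pos rfl]
  have h2 : d • ((S * T) i i * e) = d • (S i i * T i i * e) +
      ∑ a ∈ Finset.Ioi i, (c * ((s a : ℤ) : Z)) • ((S * T) i i * e - (S * T) a a * e) := by
    rw [inv_mul_apply_mul hup hdiag, smul_add, ← inv_mul_apply_mul hup hdiag, Finset.smul_sum,
      mul_assoc (S i i), hdiag, mul_smul_comm]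
    congr 1
    refine Finset.sum_congr rfl fun a ha => ?_
    rw [smul_lower_mul_upper hmix (hlow i a (Finset.mem_Ioi.1 ha)), if_pos rfl,
      ih a (Finset.mem_Ioi.1 ha)]
  have h3 := smul_diag_comm (e := e) hmix i
  rw [← sub_eq_zero]
  apply htor (rhoInt s i + s i)
  simp only [smul_sub, Finset.sum_sub_distrib, ← Finset.sum_smul, ← Finset.mul_sum,
    ← Int.cast_sum, ← rhoInt_def] at h1 h2 h3 ⊢
  push_cast
  linear_combination (norm := module) h1 - h2 + h3

include hmix htor hup hdiag hlow in
theorem diag_mul_inv_diag (i : Fin k) : T i i * S i i * e = l i • (S i i * e) := by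
  rw [← mul_smul_comm, ← hdiag, ← sub_eq_zero]
  apply htor 0
  have h3 := smul_diag_comm (e := e) hmix i
  rw [mul_inv_apply_eq hmix htor hup hdiag hlow i, sub_self, smul_zero] at h3
  rw [← mul_assoc]
  linear_combination (norm := (push_cast; module)) h3

include hmix htor hup hdiag hlow in
/-- The recursion satisfied by the diagonal entries of `T(u) T(v)⁻¹` on a highest weight vector. -/
theorem smul_mul_inv_apply (i : Fin k) : d • ((T * S) i i * e) = d • l i • (S i i * e) +
      ∑ a ∈ Finset.Ioi i, (c * ((s a : ℤ) : Z)) • ((T * S) i i * e - (T * S) a a * e) := by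
  rw [mul_inv_apply_mul hlow, smul_add, ← mul_inv_apply_mul hlow, Finset.smul_sum,
    diag_mul_inv_diag hmix htor hup hdiag hlow]
  congr 1
  refine Finset.sum_congr rfl fun a ha => ?_
  rw [smul_upper_mul_lower hmix (hup i a (Finset.mem_Ioi.1 ha)), if_pos rfl,
    mul_inv_apply_eq hmix htor hup hdiag hlow a]

theorem Ioi_eq_insert {k : ℕ} {i j : Fin k} (h : (j : ℕ) = i + 1) :
    Finset.Ioi i = insert j (Finset.Ioi j) := by
  ext a
  simp only [Finset.mem_Ioi, Finset.mem_insert, Fin.lt_def, Fin.ext_iff]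
  omega

include hmix htor hup hdiag hlow hST hT in
/-- Modulo `u - v - ρ_{i+1}`, the products `λ_i(u) t'_{ii}(v)` and `λ_{i+1}(u) t'_{i+1,i+1}(v)`
agree on a highest weight vector. -/
theorem exists_smul_inv_diag {i j : Fin k} (hij : (j : ℕ) = i + 1) :
    ∃ f : R, l i • (S i i * e) - l j • (S j j * e) = (d - rhoInt s i * c) • f := by
  have hD : ∀ i, (T * S) i i * e = e + d • ((S * τ) i i * e) := fun i => by
    rw [mul_inv_apply_eq hmix htor hup hdiag hlow, inv_mul_eq hST hT, if_pos rfl]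
  have key : ∀ i, l i • (S i i * e) = e + (d - rhoInt s i * c) • ((S * τ) i i * e) +
      c • ∑ a ∈ Finset.Ioi i, ((s a : ℤ) : Z) • ((S * τ) a a * e) := by
    intro i
    have h := smul_mul_inv_apply hmix htor hup hdiag hlow i
    simp only [hD, add_sub_add_left_eq_sub, ← smul_sub] at h
    simp only [smul_sub, Finset.sum_sub_distrib, ← Finset.sum_smul, ← Finset.mul_sum,
      ← Int.cast_sum, ← rhoInt_def] at h
    have h' : ∑ a ∈ Finset.Ioi i, (c * ((s a : ℤ) : Z)) • d • ((S * τ) a a * e) =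
        d • c • ∑ a ∈ Finset.Ioi i, ((s a : ℤ) : Z) • ((S * τ) a a * e) := by
      simp only [Finset.smul_sum, smul_smul]
      refine Finset.sum_congr rfl fun a _ => ?_
      congr 1; ring
    rw [h'] at h
    rw [← sub_eq_zero]
    apply htor 0
    linear_combination (norm := (push_cast; module)) -h
  refine ⟨(S * τ) i i * e - (S * τ) j j * e, ?_⟩
  rw [key i, key j, Ioi_eq_insert hij, Finset.sum_insert (by simp)]
  have : rhoInt s i = s j + rhoInt s j := by
    rw [rhoInt, Ioi_eq_insert hij, Finset.sum_insert (by simp), rhoInt]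
  rw [this]
  push_cast
  module

include hmix htor hup hlow in
/-- `T(u) K T(v)⁻¹` is triangular on a highest weight vector, for every diagonal matrix `K`. -/
theorem upper_mul_inv {i j : Fin k} (hij : i < j) (a : Fin k) : T i a * S a j * e = 0 := by
  rcases lt_or_ge a j with ha | ha
  · rw [mul_assoc, hlow a j ha, mul_zero]
  have h : ∀ a, j ≤ a → d • (T i a * S a j * e) = (c * ((s a : ℤ) : Z)) • ((T * S) i j * e) := by
    intro a ha
    rw [smul_upper_mul_lower hmix (hup i a (hij.trans_le ha)), if_neg hij.ne, sub_zero]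
  have hsum : (T * S) i j * e = 0 := by
    apply htor (rhoInt s j + s j)
    have h0 : (T * S) i j * e = T i j * S j j * e + ∑ a ∈ Finset.Ioi j, T i a * S a j * e := by
      rw [Matrix.mul_apply, Finset.sum_mul, sum_eq_add_sum_Ioi _ j]
      intro a ha
      rw [mul_assoc, hlow a j ha, mul_zero]
    have h1 : d • ((T * S) i j * e) = (c * ((s j : ℤ) : Z)) • ((T * S) i j * e) +
        ∑ a ∈ Finset.Ioi j, (c * ((s a : ℤ) : Z)) • ((T * S) i j * e) := by
      conv_lhs => rw [h0]
      rw [smul_add, h j le_rfl, Finset.smul_sum]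
      congr 1
      exact Finset.sum_congr rfl fun a ha => h a (Finset.mem_Ioi.1 ha).le
    rw [← Finset.sum_smul, ← Finset.mul_sum, ← Int.cast_sum, ← rhoInt_def] at h1
    push_cast
    linear_combination (norm := module) h1
  apply htor 0
  simpa [hsum] using h a ha

include hmix htor hup hdiag hlow in
/-- The diagonal entries `M_i` of `T(u) K T(v)⁻¹` on a highest weight vector, for a diagonal
matrix `K = diag(κ)`: the combinations `(u - v - ρ_{i+1}) M_i + ∑_{a > i} s_a M_a` depend on `K`
in a simple way. -/
theorem dressed_diag (κ : Fin k → Z) (i : Fin k) :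
    (d - rhoInt s i * c) • ∑ a, κ a • (T i a * S a i * e) +
      c • ∑ b ∈ Finset.Ioi i, ((s b : ℤ) : Z) • ∑ a, κ a • (T b a * S a b * e) =
    (κ i * (d - rhoInt s i * c) + c * ∑ a ∈ Finset.Ioi i, ((s a : ℤ) : Z) * κ a) •
      l i • (S i i * e) := by
  -- `F i` is evaluated by downward induction on `i`; the identity is then a combination of
  -- the recursions for `d • M i` and `d • X i`
  set M : Fin k → R := fun i => ∑ a, κ a • (T i a * S a i * e) with hM
  set X : Fin k → R := fun i => (T * S) i i * e with hX
  set F : Fin k → R := fun i => ∑ b ∈ Finset.Ioi i, ((s b : ℤ) : Z) • M b with hF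
  set K : Fin k → Z := fun i => ∑ a ∈ Finset.Ioi i, ((s a : ℤ) : Z) * κ a with hK
  set G : Fin k → R := fun i => ∑ b ∈ Finset.Ioi i, ((s b : ℤ) : Z) • X b with hG
  set H : Fin k → R := fun i => ∑ b ∈ Finset.Ioi i, (((s b : ℤ) : Z) * κ b) • X b with hH
  have hdX : ∀ i, d • X i = d • l i • (S i i * e) + (c * rhoInt s i) • X i - c • G i := by
    intro i
    have h := smul_mul_inv_apply hmix htor hup hdiag hlow i
    simp only [smul_sub, Finset.sum_sub_distrib, ← Finset.sum_smul, ← Finset.mul_sum,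
      ← Int.cast_sum, ← rhoInt_def] at h
    simp only [mul_smul, ← Finset.smul_sum] at h
    simp only [hX, hG, mul_smul]
    rw [h]
    abel
  have hdM : ∀ i, d • M i = (d * κ i) • l i • (S i i * e) + (c * K i) • X i - c • H i := by
    intro i
    have h : M i = κ i • l i • (S i i * e) +
        ∑ a ∈ Finset.Ioi i, κ a • (T i a * S a i * e) := by
      rw [hM]
      dsimp only
      rw [sum_eq_add_sum_Ioi _ i, diag_mul_inv_diag hmix htor hup hdiag hlow]
      intro a ha
      rw [mul_assoc, hlow a i ha, mul_zero, smul_zero]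
    have h' : d • ∑ a ∈ Finset.Ioi i, κ a • (T i a * S a i * e) =
        (c * K i) • X i - c • H i := by
      simp only [hK, hH, Finset.mul_sum, Finset.sum_smul, Finset.smul_sum,
        ← Finset.sum_sub_distrib]
      refine Finset.sum_congr rfl fun a ha => ?_
      rw [smul_comm, smul_upper_mul_lower hmix (hup i a (Finset.mem_Ioi.1 ha)), if_pos rfl,
        ← mul_inv_apply_eq hmix htor hup hdiag hlow a]
      simp only [hX]
      module
    rw [h, smul_add, h', smul_smul]
    abel
  have hdF : ∀ i, d • F i = (c * K i) • G i + (d - rhoInt s i * c) • H i := by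
    intro i
    induction i using WellFoundedGT.induction with
    | ind i ih =>
    by_cases hi : (i : ℕ) + 1 < k
    · obtain ⟨j, hij⟩ : ∃ j : Fin k, (j : ℕ) = i + 1 := ⟨⟨i + 1, hi⟩, rfl⟩
      have hlt : i < j := by rw [Fin.lt_def]; omega
      have e1 : F i = ((s j : ℤ) : Z) • M j + F j := by
        simp only [hF]; rw [Ioi_eq_insert hij, Finset.sum_insert (by simp)]
      have e2 : K i = ((s j : ℤ) : Z) * κ j + K j := by
        simp only [hK]; rw [Ioi_eq_insert hij, Finset.sum_insert (by simp)]
      have e3 : G i = ((s j : ℤ) : Z) • X j + G j := by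
        simp only [hG]; rw [Ioi_eq_insert hij, Finset.sum_insert (by simp)]
      have e4 : H i = (((s j : ℤ) : Z) * κ j) • X j + H j := by
        simp only [hH]; rw [Ioi_eq_insert hij, Finset.sum_insert (by simp)]
      have e5 : rhoInt s i = s j + rhoInt s j := by
        rw [rhoInt, Ioi_eq_insert hij, Finset.sum_insert (by simp), rhoInt]
      rw [e1, e2, e3, e4, e5]
      push_cast
      linear_combination (norm := module) ((s j : ℤ) : Z) • hdM j + ih j hlt -
        (((s j : ℤ) : Z) * κ j) • hdX j
    · have : Finset.Ioi i = ∅ := by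
        ext a
        have := a.2
        simp only [Finset.mem_Ioi, Fin.lt_def, Finset.notMem_empty, iff_false]
        omega
      simp [hF, hK, hG, hH, this]
  change (d - rhoInt s i * c) • M i + c • F i = (κ i * (d - rhoInt s i * c) + c * K i) • _
  rw [← sub_eq_zero]
  apply htor 0
  have h1 := hdM i
  have h2 := hdX i
  have h3 := hdF i
  push_cast
  linear_combination (norm := module) (d - rhoInt s i * c) • h1 + c • h3 + (c * K i) • h2

end HighestWeight

/-! ### Power series with noncommuting coefficients -/

open PowerSeries in
/-- Power series with central coefficients act on power series over a noncommutative algebra. -/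
noncomputable instance seriesAlgebra {Z A : Type*} [CommRing Z] [Ring A] [Algebra Z A] :
    Algebra Z⟦X⟧ A⟦X⟧ :=
  RingHom.toAlgebra' (PowerSeries.map (algebraMap Z A)) fun f g => by
    ext n
    rw [coeff_mul, coeff_mul, ← Finset.Nat.sum_antidiagonal_swap]
    refine Finset.sum_congr rfl fun p _ => ?_
    rw [coeff_map, Prod.fst_swap, Prod.snd_swap, Algebra.commutes, coeff_map]

section Series

open PowerSeries

variable {Z A : Type*} [CommRing Z] [Ring A] [Algebra Z A]

theorem algebraMap_series (f : Z⟦X⟧) :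
    algebraMap Z⟦X⟧ A⟦X⟧ f = PowerSeries.map (algebraMap Z A) f := rfl

theorem series_smul_def (f : Z⟦X⟧) (g : A⟦X⟧) :
    f • g = PowerSeries.map (algebraMap Z A) f * g := Algebra.smul_def f g

theorem X_smul_series (g : A⟦X⟧) : (X : Z⟦X⟧) • g = X * g := by
  rw [series_smul_def, map_X]

theorem C_smul_series (z : Z) (g : A⟦X⟧) :
    (C z : Z⟦X⟧) • g = C (algebraMap Z A z) * g := by
  rw [series_smul_def, map_C]

theorem series_smul_C (f : Z⟦X⟧) (a : A) (n : ℕ) :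
    coeff n (f • (C a : A⟦X⟧)) = coeff n f • a := by
  rw [series_smul_def, coeff_mul_C, coeff_map, Algebra.smul_def]

/-- The substitution `x ↦ -x` in a power series. -/
noncomputable def negX : A⟦X⟧ →+* A⟦X⟧ where
  toFun f := mk fun n => (-1 : ℤ) ^ n • coeff n f
  map_one' := by
    ext n
    rcases n with _ | n <;> simp [coeff_one]
  map_mul' f g := by
    ext n
    simp only [coeff_mk, coeff_mul, Finset.smul_sum]
    refine Finset.sum_congr rfl fun p hp => ?_
    rw [smul_mul_smul_comm, ← pow_add, Finset.HasAntidiagonal.mem_antidiagonal.1 hp]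
  map_zero' := by ext n; simp
  map_add' f g := by ext n; simp only [coeff_mk, map_add, smul_add]

theorem coeff_negX (f : A⟦X⟧) (n : ℕ) : coeff n (negX f) = (-1 : ℤ) ^ n • coeff n f := by
  change coeff n (mk fun n => (-1 : ℤ) ^ n • coeff n f) = _
  rw [coeff_mk]

theorem negX_negX (f : A⟦X⟧) : negX (negX f) = f := by
  ext n
  rw [coeff_negX, coeff_negX, smul_smul, ← mul_pow]
  simp

theorem negX_X : negX (X : A⟦X⟧) = -X := by
  ext n
  rw [coeff_negX, coeff_X, map_neg, coeff_X]
  split_ifs with h <;> simp [h]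

theorem negX_C (a : A) : negX (C a : A⟦X⟧) = C a := by
  ext n
  rw [coeff_negX, coeff_C]
  split_ifs with h <;> simp [h]

theorem negX_smul (f : Z⟦X⟧) (g : A⟦X⟧) : negX (f • g) = negX f • negX g := by
  rw [series_smul_def, map_mul, series_smul_def]
  congr 1
  ext n
  simp [coeff_negX]

/-- The inverse of a matrix of power series with constant term `1`. -/
theorem exists_matrix_inverse {ι : Type*} [Fintype ι] [DecidableEq ι] (T : Matrix ι ι A⟦X⟧)
    (hT : T.map constantCoeff = 1) :
    ∃ S : Matrix ι ι A⟦X⟧, T * S = 1 ∧ S * T = 1 ∧ S.map constantCoeff = 1 := by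
  let φ : (Matrix ι ι A)⟦X⟧ →+* Matrix ι ι A⟦X⟧ :=
    { toFun := fun F => Matrix.of fun i j => mk fun n => coeff n F i j
      map_one' := by
        ext i j n
        rcases n with _ | n <;> by_cases h : i = j <;> simp [coeff_one, Matrix.one_apply, h]
      map_mul' := fun F G => by
        ext i j n
        simp only [Matrix.of_apply, coeff_mk, Matrix.mul_apply, coeff_mul, map_sum,
          Matrix.sum_apply]
        exact Finset.sum_comm
      map_zero' := by ext i j n; simp
      map_add' := fun F G => by ext i j n; simp }
  have hφ : φ (mk fun n => T.map (coeff n)) = T := by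
    ext i j n
    simp [φ]
  set F : (Matrix ι ι A)⟦X⟧ := mk fun n => T.map (coeff n) with hF
  have hF0 : constantCoeff F = (1 : (Matrix ι ι A)ˣ) := by
    rw [hF, ← coeff_zero_eq_constantCoeff_apply, coeff_mk, Units.val_one, ← hT]
    ext i j
    simp
  have h1 : T * φ (invOfUnit F 1) = 1 := by
    conv_lhs => rw [← hφ, ← map_mul]
    rw [mul_invOfUnit F 1 hF0, map_one]
  have h2 : φ (invOfUnit F 1) * T = 1 := by
    conv_lhs => rw [← hφ, ← map_mul]
    rw [invOfUnit_mul F 1 hF0, map_one]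
  refine ⟨_, h1, h2, ?_⟩
  have h3 := congrArg (RingHom.mapMatrix (constantCoeff (R := A))) h1
  rwa [map_mul, map_one, RingHom.mapMatrix_apply, RingHom.mapMatrix_apply, hT, one_mul] at h3

end Series

section TwoVariables

open PowerSeries

variable {Z A : Type*} [CommRing Z] [Ring A] [Algebra Z A]

/-- A series in `u⁻¹`, as a series in `u⁻¹` and `v⁻¹`. Series in two variables are series in
`x = u⁻¹` whose coefficients are series in `y = v⁻¹`. -/
noncomputable def inU : A⟦X⟧ →+* A⟦X⟧⟦X⟧ := PowerSeries.map C

/-- A series in `v⁻¹`, as a series in `u⁻¹` and `v⁻¹`. -/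
noncomputable def inV : A⟦X⟧ →+* A⟦X⟧⟦X⟧ := C

/-- The coefficient of a power series at an integer, which is `0` at a negative integer. -/
noncomputable def zcoeff (n : ℤ) (f : A⟦X⟧) : A := if 0 ≤ n then coeff n.toNat f else 0

/-- The coefficient of `u^{-m} v^{-n}`. -/
noncomputable def zcoeff₂ (m n : ℤ) (F : A⟦X⟧⟦X⟧) : A := zcoeff n (zcoeff m F)

theorem zcoeff_natCast (n : ℕ) (f : A⟦X⟧) : zcoeff n f = coeff n f := by simp [zcoeff]

theorem zcoeff_of_neg {n : ℤ} (h : n < 0) (f : A⟦X⟧) : zcoeff n f = 0 := by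
  simp [zcoeff, not_le.2 h]

theorem zcoeff_add (n : ℤ) (f g : A⟦X⟧) : zcoeff n (f + g) = zcoeff n f + zcoeff n g := by
  unfold zcoeff; split_ifs <;> simp

theorem zcoeff_sub (n : ℤ) (f g : A⟦X⟧) : zcoeff n (f - g) = zcoeff n f - zcoeff n g := by
  unfold zcoeff; split_ifs <;> simp

theorem zcoeff_zsmul (n z : ℤ) (f : A⟦X⟧) : zcoeff n (z • f) = z • zcoeff n f := by
  unfold zcoeff; split_ifs
  · exact map_zsmul _ _ _
  · simp

theorem zcoeff_X_mul (n : ℤ) (f : A⟦X⟧) : zcoeff n (X * f) = zcoeff (n - 1) f := by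
  rcases lt_trichotomy n 0 with h | rfl | h
  · rw [zcoeff_of_neg h, zcoeff_of_neg (by omega)]
  · rw [zcoeff_of_neg (n := 0 - 1) (by omega)]
    simp [zcoeff]
  · obtain ⟨m, rfl⟩ : ∃ m : ℕ, n = ((m + 1 : ℕ) : ℤ) := ⟨(n - 1).toNat, by omega⟩
    rw [zcoeff_natCast, coeff_succ_X_mul]
    rw [show ((m + 1 : ℕ) : ℤ) - 1 = m by push_cast; ring, zcoeff_natCast]

theorem zcoeff_C_mul (n : ℤ) (a : A) (f : A⟦X⟧) : zcoeff n (C a * f) = a * zcoeff n f := by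
  unfold zcoeff; split_ifs <;> simp

theorem zcoeff_mul_C (n : ℤ) (a : A) (f : A⟦X⟧) : zcoeff n (f * C a) = zcoeff n f * a := by
  unfold zcoeff; split_ifs <;> simp

theorem zcoeff_inU (m : ℤ) (f : A⟦X⟧) : zcoeff m (inU f) = C (zcoeff m f) := by
  unfold zcoeff; split_ifs <;> simp [inU]

theorem zcoeff₂_add (m n : ℤ) (F G : A⟦X⟧⟦X⟧) :
    zcoeff₂ m n (F + G) = zcoeff₂ m n F + zcoeff₂ m n G := by
  simp only [zcoeff₂, zcoeff_add]

theorem zcoeff₂_sub (m n : ℤ) (F G : A⟦X⟧⟦X⟧) :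
    zcoeff₂ m n (F - G) = zcoeff₂ m n F - zcoeff₂ m n G := by
  simp only [zcoeff₂, zcoeff_sub]

theorem zcoeff₂_zsmul (m n z : ℤ) (F : A⟦X⟧⟦X⟧) :
    zcoeff₂ m n (z • F) = z • zcoeff₂ m n F := by
  simp only [zcoeff₂, zcoeff_zsmul]

theorem zcoeff₂_X_smul (m n : ℤ) (F : A⟦X⟧⟦X⟧) :
    zcoeff₂ m n ((X : Z⟦X⟧⟦X⟧) • F) = zcoeff₂ (m - 1) n F := by
  rw [X_smul_series, zcoeff₂, zcoeff_X_mul, zcoeff₂]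

theorem zcoeff₂_C_X_smul (m n : ℤ) (F : A⟦X⟧⟦X⟧) :
    zcoeff₂ m n ((C X : Z⟦X⟧⟦X⟧) • F) = zcoeff₂ m (n - 1) F := by
  rw [C_smul_series, zcoeff₂, zcoeff_C_mul, algebraMap_series, map_X, zcoeff_X_mul, zcoeff₂]

theorem zcoeff₂_inU_mul_inV (m n : ℤ) (f g : A⟦X⟧) :
    zcoeff₂ m n (inU f * inV g) = zcoeff m f * zcoeff n g := by
  rw [zcoeff₂, inV, zcoeff_mul_C, zcoeff_inU, zcoeff_C_mul]

theorem zcoeff₂_inV_mul_inU (m n : ℤ) (f g : A⟦X⟧) :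
    zcoeff₂ m n (inV g * inU f) = zcoeff n g * zcoeff m f := by
  rw [zcoeff₂, inV, zcoeff_C_mul, zcoeff_inU, zcoeff_mul_C]

theorem ext_zcoeff₂ {F G : A⟦X⟧⟦X⟧} (h : ∀ m n, zcoeff₂ m n F = zcoeff₂ m n G) : F = G := by
  ext m n
  simpa only [zcoeff₂, zcoeff_natCast] using h m n

/-- `u - v - r` is not a zero divisor. The scalar here is `u⁻¹ v⁻¹ (u - v - r)`. -/
theorem eq_zero_of_sub_smul_eq_zero (r : ℤ) (F : A⟦X⟧⟦X⟧)
    (h : ((C X - X : Z⟦X⟧⟦X⟧) - (r : Z⟦X⟧⟦X⟧) * (X * C X)) • F = 0) : F = 0 := by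
  have h1 : C (X : A⟦X⟧) * F = X * (F + r • (C (X : A⟦X⟧) * F)) := by
    have h2 : C (X : A⟦X⟧) * F = (C X : Z⟦X⟧⟦X⟧) • F := by
      rw [C_smul_series, algebraMap_series, map_X]
    rw [h2, ← X_smul_series (Z := Z⟦X⟧), ← sub_eq_zero, ← Int.cast_smul_eq_zsmul Z⟦X⟧⟦X⟧,
      ← h, smul_add, ← sub_sub]
    simp only [sub_smul, smul_smul]
    congr 2
    ring
  ext1 n
  induction n with
  | zero =>
    have := congrArg (coeff 0) h1
    rw [coeff_C_mul, coeff_zero_X_mul] at this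
    rw [map_zero]
    exact X_mul_cancel (this.trans (mul_zero _).symm)
  | succ n ih =>
    have := congrArg (coeff (n + 1)) h1
    rw [coeff_C_mul, coeff_succ_X_mul, map_add, map_zsmul, coeff_C_mul, ih] at this
    rw [map_zero]
    refine X_mul_cancel (this.trans ?_)
    simp

/-- A series in `v⁻¹` which is divisible by `u⁻¹ - p(v⁻¹)` vanishes. -/
theorem eq_zero_of_inV_eq_smul {p : Z⟦X⟧} (hp : constantCoeff p = 0) {f : A⟦X⟧} {Q : A⟦X⟧⟦X⟧}
    (h : inV f = (X - C p : Z⟦X⟧⟦X⟧) • Q) : f = 0 := by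
  have hX : ∀ n, coeff (n + 1) (X * Q) = coeff n Q := fun n => coeff_succ_X_mul n Q
  rw [sub_smul, X_smul_series, C_smul_series] at h
  have h0 : f = -(p • coeff 0 Q) := by
    have := congrArg (coeff 0) h
    rwa [inV, coeff_zero_C, map_sub, coeff_zero_X_mul, coeff_C_mul, ← Algebra.smul_def,
      zero_sub] at this
  have hs : ∀ n, coeff n Q = p • coeff (n + 1) Q := fun n => by
    have := congrArg (coeff (n + 1)) h
    rw [inV, coeff_C, if_neg (Nat.succ_ne_zero _), map_sub, hX, coeff_C_mul,
      ← Algebra.smul_def] at this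
    exact (sub_eq_zero.1 this.symm)
  have hpow : ∀ n, coeff 0 Q = p ^ n • coeff n Q := fun n => by
    induction n with
    | zero => simp
    | succ n ih => rw [ih, hs n, smul_smul, ← pow_succ]
  obtain ⟨p', rfl⟩ := X_dvd_iff.2 hp
  have hQ : coeff 0 Q = 0 := by
    ext n
    rw [hpow (n + 1), mul_pow, mul_smul, series_smul_def, map_pow, map_X, coeff_X_pow_mul',
      if_neg (by omega), map_zero]
  rw [h0, hQ, smul_zero, neg_zero]

/-- A series in `u⁻¹` is congruent modulo `u⁻¹ - p(v⁻¹)` to the one in `v⁻¹` obtained by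
substitution. -/
theorem exists_inU_eq_subst {p : Z⟦X⟧} (hp : constantCoeff p = 0) (f : Z⟦X⟧) :
    ∃ Q : Z⟦X⟧⟦X⟧, inU f = inV (f.subst p) + (X - C p) * Q := by
  have hsub := HasSubst.of_constantCoeff_zero' hp
  have hshift : ∀ i, (mk fun n => coeff (n + i) f).subst p =
      C (coeff i f) + p * (mk fun n => coeff (n + (i + 1)) f).subst p := fun i => by
    have h : (mk fun n => coeff (n + i) f) =
        C (coeff i f) + X * mk fun n => coeff (n + (i + 1)) f := by
      ext n
      rcases n with _ | n
      · simp
      · rw [map_add, coeff_succ_X_mul, coeff_C, if_neg (Nat.succ_ne_zero _), coeff_mk,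
          coeff_mk, zero_add]
        rw [show n + 1 + i = n + (i + 1) by omega]
    rw [h, subst_add hsub, subst_mul hsub, subst_X hsub, subst_C]
    rfl
  refine ⟨mk fun i => (mk fun n => coeff (n + (i + 1)) f).subst p, ?_⟩
  ext1 i
  rw [sub_mul, map_add, map_sub, coeff_C_mul, coeff_mk, inU, coeff_map, inV]
  rcases i with _ | i
  · rw [coeff_zero_C, coeff_zero_X_mul, zero_sub]
    have := hshift 0
    simp only [add_zero] at this
    rw [show (mk fun n => coeff n f) = f from by ext; simp] at this
    rw [this]
    ring
  · rw [coeff_C, if_neg (Nat.succ_ne_zero _), coeff_succ_X_mul, coeff_mk, hshift (i + 1)]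
    ring

/-- `f(u) - f(v)` is divisible by `u - v`. -/
theorem exists_inU_eq_inV_add (f : A⟦X⟧) :
    ∃ Q : A⟦X⟧⟦X⟧, inU f = inV f + (C X - X : Z⟦X⟧⟦X⟧) • Q := by
  refine ⟨mk fun i => mk fun j => -coeff (i + j + 1) f, ?_⟩
  rw [sub_smul, C_smul_series, X_smul_series, algebraMap_series, map_X]
  ext m n
  rw [inU, inV, coeff_map, map_add, map_add, map_sub, map_sub, coeff_C_mul, coeff_mk]
  rcases m with _ | m <;> rcases n with _ | n <;>
    simp [coeff_C, coeff_succ_X_mul, coeff_zero_X_mul, add_assoc, add_comm, add_left_comm]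

/-- A series in `u⁻¹` which is divisible by `u⁻¹ + v⁻¹` vanishes. -/
theorem eq_zero_of_inU_eq_mul {f : A⟦X⟧} {Q : A⟦X⟧⟦X⟧} (h : inU f = (X + C X) * Q) : f = 0 := by
  have hc : ∀ m n, coeff n (coeff m (inU f)) =
      coeff n (coeff m (X * Q)) + coeff n (X * coeff m Q) := fun m n => by
    rw [h, add_mul, map_add, map_add, coeff_C_mul]
  have hQ : Q = 0 := by
    ext m n
    induction m generalizing n with
    | zero =>
      have := hc 0 (n + 1)
      rw [inU, coeff_map, coeff_C, if_neg (Nat.succ_ne_zero _), coeff_zero_X_mul, map_zero,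
        zero_add, coeff_succ_X_mul] at this
      simpa using this.symm
    | succ m ih =>
      have := hc (m + 1) (n + 1)
      rw [inU, coeff_map, coeff_C, if_neg (Nat.succ_ne_zero _), coeff_succ_X_mul, ih,
        coeff_succ_X_mul] at this
      simpa using this.symm
  ext n
  have := hc n 0
  rw [hQ, mul_zero, inU, coeff_map, coeff_zero_C] at this
  simpa using this

/-- The specialization `v = -u`. -/
noncomputable def antidiag (F : A⟦X⟧⟦X⟧) : A⟦X⟧ :=
  mk fun N => ∑ p ∈ Finset.HasAntidiagonal.antidiagonal N,
    (-1 : ℤ) ^ p.2 • coeff p.2 (coeff p.1 F)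

theorem exists_eq_inU_antidiag_add (F : A⟦X⟧⟦X⟧) :
    ∃ Q : A⟦X⟧⟦X⟧, F = inU (antidiag F) + (X + C X) * Q := by
  let g : ℕ → ℕ → A := fun m j => ∑ p ∈ Finset.HasAntidiagonal.antidiagonal m,
    (-1 : ℤ) ^ p.2 • coeff (j + p.2) (coeff p.1 F)
  have g0 : ∀ j, g 0 j = coeff j (coeff 0 F) := fun j => by simp [g]
  have gs : ∀ m j, g (m + 1) j = coeff j (coeff (m + 1) F) - g m (j + 1) := fun m j => by
    simp only [g, Finset.Nat.sum_antidiagonal_succ', pow_succ, pow_zero, one_smul, mul_neg_one,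
      neg_smul, Finset.sum_neg_distrib, add_zero, sub_eq_add_neg]
    simp only [add_comm, add_left_comm]
  have hg : ∀ m, coeff m (antidiag F) = g m 0 := fun m => by simp [antidiag, g]
  refine ⟨mk fun i => mk fun j => g i (j + 1), ?_⟩
  ext m n
  rw [add_mul, map_add, map_add, map_add, map_add, coeff_C_mul, inU, coeff_map, hg]
  rcases m with _ | m <;> rcases n with _ | n
  · simp [g0]
  · simp [coeff_succ_X_mul, g0]
  · simp [coeff_succ_X_mul, gs]
  · simp [coeff_succ_X_mul, gs]

theorem antidiag_eq {F : A⟦X⟧⟦X⟧} {f : A⟦X⟧} {Q : A⟦X⟧⟦X⟧} (h : F = inU f + (X + C X) * Q) :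
    antidiag F = f := by
  obtain ⟨Q', h'⟩ := exists_eq_inU_antidiag_add F
  rw [← sub_eq_zero]
  refine eq_zero_of_inU_eq_mul (Q := Q - Q') ?_
  rw [map_sub, mul_sub, sub_eq_sub_iff_add_eq_add, ← h', h, add_comm]

theorem antidiag_inU (f : A⟦X⟧) : antidiag (inU f) = f := antidiag_eq (Q := 0) (by simp)

theorem antidiag_add (F G : A⟦X⟧⟦X⟧) : antidiag (F + G) = antidiag F + antidiag G := by
  ext n; simp [antidiag, Finset.sum_add_distrib]

theorem antidiag_zero : antidiag (0 : A⟦X⟧⟦X⟧) = 0 := by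
  ext n; simp [antidiag]

theorem commute_X_add_C_X (F : A⟦X⟧⟦X⟧) : Commute (X + C X) F := by
  refine (commute_X F).symm.add_left ?_
  ext n
  rw [coeff_C_mul, coeff_mul_C, (commute_X _).eq]

theorem antidiag_mul (F G : A⟦X⟧⟦X⟧) : antidiag (F * G) = antidiag F * antidiag G := by
  obtain ⟨Q, hF⟩ := exists_eq_inU_antidiag_add F
  obtain ⟨Q', hG⟩ := exists_eq_inU_antidiag_add G
  refine antidiag_eq (Q := Q * G + inU (antidiag F) * Q') ?_
  calc F * G = inU (antidiag F) * G + (X + C X) * Q * G := by rw [← add_mul, ← hF]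
    _ = inU (antidiag F) * (inU (antidiag G) + (X + C X) * Q') + (X + C X) * Q * G := by
        rw [← hG]
    _ = _ := by
        rw [mul_add, ← mul_assoc _ (X + C X), ← (commute_X_add_C_X (inU (antidiag F))).eq,
          map_mul, mul_add]
        simp only [mul_assoc]
        abel

theorem antidiag_inV (f : A⟦X⟧) : antidiag (inV f) = negX f := by
  ext n
  rw [antidiag, coeff_mk, Finset.sum_eq_single (0, n)]
  · rw [inV, coeff_zero_C, coeff_negX]
  · rintro ⟨a, b⟩ hp hne
    have hp := Finset.HasAntidiagonal.mem_antidiagonal.1 hp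
    have ha : a ≠ 0 := by
      rintro rfl
      exact hne (by simpa using hp)
    simp [inV, coeff_C, ha]
  · simp [Finset.HasAntidiagonal.mem_antidiagonal]

theorem antidiag_smul (f : Z⟦X⟧⟦X⟧) (F : A⟦X⟧⟦X⟧) :
    antidiag (f • F) = antidiag f • antidiag F := by
  rw [series_smul_def, antidiag_mul, series_smul_def]
  congr 1
  ext n
  simp [antidiag, algebraMap_series]

theorem negX_inU (f : A⟦X⟧) : negX (inU f) = inU (negX f) := by
  ext n m
  simp [coeff_negX, inU, -zsmul_eq_mul]

theorem negX_inV (f : A⟦X⟧) : negX (inV f) = inV f := negX_C f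

/-- The substitution `v ↦ -v`. -/
noncomputable def negV : A⟦X⟧⟦X⟧ →+* A⟦X⟧⟦X⟧ := PowerSeries.map negX

theorem negV_inU (f : A⟦X⟧) : negV (inU f) = inU f := by
  ext1 n
  rw [negV, coeff_map, inU, coeff_map, negX_C]

theorem negV_inV (f : A⟦X⟧) : negV (inV f) = inV (negX f) := by
  simp [negV, inV]

theorem negV_smul (f : Z⟦X⟧⟦X⟧) (F : A⟦X⟧⟦X⟧) : negV (f • F) = negV f • negV F := by
  rw [series_smul_def, map_mul, series_smul_def]
  congr 1
  ext n m
  simp [negV, coeff_negX, algebraMap_series]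

theorem negV_X : negV (X : A⟦X⟧⟦X⟧) = X := by rw [negV, map_X]

theorem negV_C_X : negV (C X : A⟦X⟧⟦X⟧) = -C X := by rw [negV, map_C, negX_X, map_neg]

theorem inU_smul (f : Z⟦X⟧) (g : A⟦X⟧) : inU (f • g) = inU f • inU g := by
  rw [series_smul_def, map_mul, series_smul_def]
  congr 1
  ext n m
  simp [inU, algebraMap_series]

theorem inV_smul (f : Z⟦X⟧) (g : A⟦X⟧) : inV (f • g) = inV f • inV g := by
  rw [series_smul_def, map_mul, series_smul_def, ← algebraMap_series f]
  simp [inV]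

end TwoVariables

/-! ### The homomorphism from the twisted super Yangian -/

section Relations

open PowerSeries

variable {k : ℕ} (s : Fin k → ℤˣ) {A : Type*} [Ring A] [Algebra ℂ A]

theorem superComm_eq (i j p q : Fin k) (x y : A) :
    superComm s i j p q x y = x * y - commSign s i j p q • (y * x) := by
  rw [superComm, ← Int.cast_smul_eq_zsmul ℂ]
  congr 2
  simp only [commSign, chi]
  push_cast
  simp only [← pow_add]
  congr 1
  ring

theorem sign3_smul (i j p : Fin k) (x : A) : sign3 s i j p • x = tripleSign s i j p • x := by
  rw [sign3, ← Int.cast_smul_eq_zsmul ℂ]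
  congr 1
  simp only [tripleSign, chi]
  push_cast
  simp only [← pow_add]

/-- The matrix `T` of series satisfies the defining relations of the super Yangian. -/
def IsRTT (T : Matrix (Fin k) (Fin k) A⟦X⟧) : Prop :=
  ∀ (i j p q : Fin k) (m n : ℤ),
    superComm s i j p q (zcoeff (m + 1) (T i j)) (zcoeff n (T p q)) -
        superComm s i j p q (zcoeff m (T i j)) (zcoeff (n + 1) (T p q)) =
      sign3 s i j p • (zcoeff m (T p j) * zcoeff n (T i q) - zcoeff n (T p j) * zcoeff m (T i q))

variable {s} {T : Matrix (Fin k) (Fin k) A⟦X⟧}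

theorem IsRTT.inU_inV (h : IsRTT s T) (i j p q : Fin k) :
    (C X - X : ℂ⟦X⟧⟦X⟧) • (inU (T i j) * inV (T p q) -
        commSign s i j p q • (inV (T p q) * inU (T i j))) =
      (X * C X : ℂ⟦X⟧⟦X⟧) • tripleSign s i j p •
        (inU (T p j) * inV (T i q) - inV (T p j) * inU (T i q)) := by
  refine ext_zcoeff₂ fun m n => ?_
  have h := h i j p q (m - 1) (n - 1)
  rw [superComm_eq, superComm_eq, sign3_smul, sub_add_cancel, sub_add_cancel] at h
  simp only [sub_smul, mul_smul, zcoeff₂_sub, zcoeff₂_C_X_smul, zcoeff₂_X_smul, zcoeff₂_zsmul,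
    zcoeff₂_inU_mul_inV, zcoeff₂_inV_mul_inU]
  exact h

theorem IsRTT.inV_inU (h : IsRTT s T) (i j p q : Fin k) :
    (X - C X : ℂ⟦X⟧⟦X⟧) • (inV (T i j) * inU (T p q) -
        commSign s i j p q • (inU (T p q) * inV (T i j))) =
      (X * C X : ℂ⟦X⟧⟦X⟧) • tripleSign s i j p •
        (inV (T p j) * inU (T i q) - inU (T p j) * inV (T i q)) := by
  refine ext_zcoeff₂ fun m n => ?_
  have h := h i j p q (n - 1) (m - 1)
  rw [superComm_eq, superComm_eq, sign3_smul, sub_add_cancel, sub_add_cancel] at h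
  simp only [sub_smul, mul_smul, zcoeff₂_sub, zcoeff₂_C_X_smul, zcoeff₂_X_smul, zcoeff₂_zsmul,
    zcoeff₂_inU_mul_inV, zcoeff₂_inV_mul_inU]
  exact h

/-- A matrix of series in `u⁻¹`, as a matrix of series in `u⁻¹` and `v⁻¹`. -/
noncomputable def matU : Matrix (Fin k) (Fin k) A⟦X⟧ →+* Matrix (Fin k) (Fin k) A⟦X⟧⟦X⟧ :=
  RingHom.mapMatrix inU

/-- A matrix of series in `v⁻¹`, as a matrix of series in `u⁻¹` and `v⁻¹`. -/
noncomputable def matV : Matrix (Fin k) (Fin k) A⟦X⟧ →+* Matrix (Fin k) (Fin k) A⟦X⟧⟦X⟧ :=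
  RingHom.mapMatrix inV

/-- The substitution `x ↦ -x` in a matrix of power series. -/
noncomputable def matNeg : Matrix (Fin k) (Fin k) A⟦X⟧ →+* Matrix (Fin k) (Fin k) A⟦X⟧ :=
  RingHom.mapMatrix negX

variable (s A) in
/-- The matrix `u⁻¹ v⁻¹ (u - v - P)`, with `P` the super flip. -/
noncomputable def rMinus : Matrix (Fin k × Fin k) (Fin k × Fin k) A⟦X⟧⟦X⟧ :=
  (C X - X : ℂ⟦X⟧⟦X⟧) • 1 - (X * C X : ℂ⟦X⟧⟦X⟧) • superSwap s A⟦X⟧⟦X⟧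

variable (s A) in
/-- The matrix `u⁻¹ v⁻¹ (u + v - P)`, with `P` the super flip. -/
noncomputable def rPlus : Matrix (Fin k × Fin k) (Fin k × Fin k) A⟦X⟧⟦X⟧ :=
  (C X + X : ℂ⟦X⟧⟦X⟧) • 1 - (X * C X : ℂ⟦X⟧⟦X⟧) • superSwap s A⟦X⟧⟦X⟧

theorem IsRTT.rtt_u_v (h : IsRTT s T) :
    rMinus s A * tensorLeft s (matU T) * tensorRight (matV T) =
      tensorRight (matV T) * tensorLeft s (matU T) * rMinus s A :=
  rtt_matrix s fun i j p q => h.inU_inV i j p q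

theorem neg_smul_sub_neg_smul {Z M : Type*} [CommRing Z] [AddCommGroup M] [Module Z M] (d c : Z)
    (x y : M) : (-d) • x - (-c) • y = -(d • x - c • y) := by module

theorem IsRTT.rtt_u_neg_v (h : IsRTT s T) :
    rPlus s A * tensorLeft s (matU T) * tensorRight (matV (matNeg T)) =
      tensorRight (matV (matNeg T)) * tensorLeft s (matU T) * rPlus s A := by
  have := rtt_matrix (T := matU T) (T' := matV (matNeg T)) (d := (-(C X + X) : ℂ⟦X⟧⟦X⟧))
    (c := -(X * C X)) s fun i j p q => by
      have h := congrArg negV (h.inU_inV i j p q)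
      simp only [negV_smul, map_sub, map_mul, map_zsmul, negV_X, negV_C_X, negV_inU,
        negV_inV] at h
      rw [neg_add', neg_mul_eq_mul_neg]
      exact h
  rw [neg_smul_sub_neg_smul, neg_mul, neg_mul, mul_neg, neg_inj] at this
  exact this

theorem IsRTT.rtt_v_neg_u (h : IsRTT s T) :
    rPlus s A * tensorLeft s (matV T) * tensorRight (matU (matNeg T)) =
      tensorRight (matU (matNeg T)) * tensorLeft s (matV T) * rPlus s A := by
  have := rtt_matrix (T := matV T) (T' := matU (matNeg T)) (d := (-(C X + X) : ℂ⟦X⟧⟦X⟧))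
    (c := -(X * C X)) s fun i j p q => by
      have h := congrArg negX (h.inV_inU i j p q)
      simp only [negX_smul, map_sub, map_mul, map_zsmul, negX_X, negX_C, negX_inU,
        negX_inV] at h
      rw [neg_add_rev, ← sub_eq_add_neg, neg_mul_eq_neg_mul]
      exact h
  rw [neg_smul_sub_neg_smul, neg_mul, neg_mul, mul_neg, neg_inj] at this
  exact this

theorem IsRTT.rtt_neg_v_neg_u (h : IsRTT s T) :
    rMinus s A * tensorLeft s (matV (matNeg T)) * tensorRight (matU (matNeg T)) =
      tensorRight (matU (matNeg T)) * tensorLeft s (matV (matNeg T)) * rMinus s A :=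
  rtt_matrix s fun i j p q => by
    have h := congrArg negV (congrArg negX (h.inV_inU i j p q))
    simp only [negX_smul, map_sub, map_mul, map_zsmul, negX_X, negX_C, negX_inU,
      negX_inV, negV_smul, map_neg, negV_X, negV_C_X, negV_inU, negV_inV, neg_mul_neg,
      sub_neg_eq_add, neg_add_eq_sub] at h
    exact h

/-- Conjugation by the super flip exchanges the tensor factors in an `RTT` relation. -/
theorem rtt_flip {R : Type*} [Ring R] {r : Matrix (Fin k × Fin k) (Fin k × Fin k) R}
    (hr : superSwap s R * r = r * superSwap s R) {M N : Matrix (Fin k) (Fin k) R}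
    (h : r * tensorLeft s M * tensorRight N = tensorRight N * tensorLeft s M * r) :
    r * tensorRight M * tensorLeft s N = tensorLeft s N * tensorRight M * r := by
  have h := congrArg (fun x => superSwap s R * x * superSwap s R) h
  have h1 : ∀ x, superSwap s R * (tensorLeft s M * x) = tensorRight M * (superSwap s R * x) :=
    fun x => by rw [← mul_assoc, superSwap_mul_tensorLeft, mul_assoc]
  have h2 : ∀ x, superSwap s R * (tensorRight N * x) = tensorLeft s N * (superSwap s R * x) :=
    fun x => by rw [← mul_assoc, superSwap_mul_tensorRight, mul_assoc]
  have h3 : ∀ x, superSwap s R * (r * x) = r * (superSwap s R * x) :=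
    fun x => by rw [← mul_assoc, hr, mul_assoc]
  simp only [mul_assoc, h1, h2, h3, superSwap_mul_self, mul_one, superSwap_mul_tensorRight, ← hr]
    at h
  simpa only [← mul_assoc, superSwap_mul_tensorLeft, superSwap_mul_self, mul_one, one_mul]
    using h

theorem superSwap_mul_rPlus : superSwap s A⟦X⟧⟦X⟧ * rPlus s A = rPlus s A * superSwap s _ := by
  simp only [rPlus, mul_sub, sub_mul, mul_smul_comm, smul_mul_assoc, mul_one, one_mul]

theorem superSwap_mul_rMinus : superSwap s A⟦X⟧⟦X⟧ * rMinus s A = rMinus s A * superSwap s _ := by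
  simp only [rMinus, mul_sub, sub_mul, mul_smul_comm, smul_mul_assoc, mul_one, one_mul]

theorem tensorLeft_smul {Z R : Type*} [CommRing Z] [Ring R] [Algebra Z R] (z : Z)
    (M : Matrix (Fin k) (Fin k) R) : tensorLeft s (z • M) = z • tensorLeft s M := by
  ext x y
  simp only [tensorLeft, Matrix.smul_apply]
  split_ifs
  · exact smul_comm _ _ _
  · simp

theorem tensorLeft_add {R : Type*} [Ring R] (M N : Matrix (Fin k) (Fin k) R) :
    tensorLeft s (M + N) = tensorLeft s M + tensorLeft s N := by
  ext x y
  simp only [tensorLeft, Matrix.add_apply]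
  split_ifs
  · exact smul_add _ _ _
  · simp

theorem tensorLeft_diagonal_comm {R : Type*} [Ring R] (D : Fin k → R)
    (M : Matrix (Fin k) (Fin k) R) (hD : ∀ a p q, Commute (D a) (M p q)) :
    tensorLeft s (Matrix.diagonal D) * tensorRight M =
      tensorRight M * tensorLeft s (Matrix.diagonal D) := by
  ext ⟨i, p⟩ ⟨j, q⟩
  rw [tensorLeft_mul_tensorRight_apply, tensorRight_mul_tensorLeft_apply]
  by_cases h : i = j
  · subst h
    rw [Matrix.diagonal_apply_eq, chi_mul_self, chi_mul_self, (hD i p q).eq]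
  · rw [Matrix.diagonal_apply_ne _ h]
    simp

theorem tensorLeft_comm_diagonal {R : Type*} [Ring R] (D : Fin k → R)
    (M : Matrix (Fin k) (Fin k) R) (hD : ∀ a p q, Commute (D a) (M p q)) :
    tensorLeft s M * tensorRight (Matrix.diagonal D) =
      tensorRight (Matrix.diagonal D) * tensorLeft s M := by
  ext ⟨i, p⟩ ⟨j, q⟩
  rw [tensorLeft_mul_tensorRight_apply, tensorRight_mul_tensorLeft_apply]
  by_cases h : p = q
  · subst h
    rw [Matrix.diagonal_apply_eq, (hD p i j).eq]
  · rw [Matrix.diagonal_apply_ne _ h]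
    simp

/-- The solution `E + γ u⁻¹`, `E = diag(ε)`, of the reflection equation, times the scalar series
`h`. -/
noncomputable def kMatrix (ε : Fin k → ℤˣ) (γ : ℂ) (h : ℂ⟦X⟧) :
    Matrix (Fin k) (Fin k) A⟦X⟧ :=
  Matrix.diagonal fun a => (h * (C ((ε a : ℤ) : ℂ) + C γ * X)) • (1 : A⟦X⟧)

/-- The matrix `T(u) K(u) T(-u)⁻¹`, where `S` stands for `T(u)⁻¹`. -/
noncomputable def dressed (T S : Matrix (Fin k) (Fin k) A⟦X⟧) (ε : Fin k → ℤˣ) (γ : ℂ)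
    (h : ℂ⟦X⟧) : Matrix (Fin k) (Fin k) A⟦X⟧ :=
  T * kMatrix ε γ h * matNeg S

theorem matU_kMatrix (ε : Fin k → ℤˣ) (γ : ℂ) (h : ℂ⟦X⟧) :
    matU (A := A) (kMatrix ε γ h) = (inU h : ℂ⟦X⟧⟦X⟧) •
      (Matrix.diagonal (fun a => (((ε a : ℤ) : A⟦X⟧⟦X⟧))) + (C (C γ) * X : ℂ⟦X⟧⟦X⟧) • 1) := by
  ext1 i j
  rw [matU, RingHom.mapMatrix_apply, Matrix.map_apply, kMatrix, Matrix.smul_apply,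
    Matrix.add_apply, Matrix.smul_apply]
  by_cases hij : i = j
  · subst hij
    rw [Matrix.diagonal_apply_eq, Matrix.diagonal_apply_eq, Matrix.one_apply_eq, inU_smul,
      map_one, map_mul, mul_smul, map_add, add_smul]
    have h1 : (inU (C ((ε i : ℤ) : ℂ)) : ℂ⟦X⟧⟦X⟧) = ((ε i : ℤ) : ℂ⟦X⟧⟦X⟧) := by
      simp only [map_intCast]
    have h2 : (inU (C γ * X) : ℂ⟦X⟧⟦X⟧) = C (C γ) * X := by simp [inU]
    rw [h1, h2, Int.cast_smul_eq_zsmul, zsmul_one]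
  · rw [Matrix.diagonal_apply_ne _ hij, Matrix.diagonal_apply_ne _ hij, Matrix.one_apply_ne hij,
      map_zero, smul_zero, add_zero, smul_zero]

theorem matV_kMatrix (ε : Fin k → ℤˣ) (γ : ℂ) (h : ℂ⟦X⟧) :
    matV (A := A) (kMatrix ε γ h) = (inV h : ℂ⟦X⟧⟦X⟧) •
      (Matrix.diagonal (fun a => (((ε a : ℤ) : A⟦X⟧⟦X⟧))) + (C (C γ) * C X : ℂ⟦X⟧⟦X⟧) • 1) := by
  ext1 i j
  rw [matV, RingHom.mapMatrix_apply, Matrix.map_apply, kMatrix, Matrix.smul_apply,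
    Matrix.add_apply, Matrix.smul_apply]
  by_cases hij : i = j
  · subst hij
    rw [Matrix.diagonal_apply_eq, Matrix.diagonal_apply_eq, Matrix.one_apply_eq, inV_smul,
      map_one, map_mul, mul_smul, map_add, add_smul]
    have h1 : (inV (C ((ε i : ℤ) : ℂ)) : ℂ⟦X⟧⟦X⟧) = ((ε i : ℤ) : ℂ⟦X⟧⟦X⟧) := by
      simp only [map_intCast]
    have h2 : (inV (C γ * X) : ℂ⟦X⟧⟦X⟧) = C (C γ) * C X := by simp [inV]
    rw [h1, h2, Int.cast_smul_eq_zsmul, zsmul_one]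
  · rw [Matrix.diagonal_apply_ne _ hij, Matrix.diagonal_apply_ne _ hij, Matrix.one_apply_ne hij,
      map_zero, smul_zero, add_zero, smul_zero]

theorem kMatrix_reflection (ε : Fin k → ℤˣ) (γ : ℂ) (h : ℂ⟦X⟧) :
    rMinus s A * tensorLeft s (matU (kMatrix ε γ h)) * rPlus s A *
        tensorRight (matV (kMatrix ε γ h)) =
      tensorRight (matV (kMatrix ε γ h)) * rPlus s A * tensorLeft s (matU (kMatrix ε γ h)) *
        rMinus s A := by
  set E : Matrix (Fin k) (Fin k) A⟦X⟧⟦X⟧ := Matrix.diagonal (fun a => (((ε a : ℤ) : A⟦X⟧⟦X⟧)))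
    with hE
  have hEE : E * E = 1 := by
    rw [hE, Matrix.diagonal_mul_diagonal, ← Matrix.diagonal_one]
    congr 1
    funext a
    rcases Int.units_eq_one_or (ε a) with h | h <;> simp [h]
  have h1 : tensorLeft s (matU (A := A) (kMatrix ε γ h)) =
      (inU h : ℂ⟦X⟧⟦X⟧) • (tensorLeft s E + (C (C γ) * X : ℂ⟦X⟧⟦X⟧) • 1) := by
    rw [matU_kMatrix, tensorLeft_smul, tensorLeft_add, tensorLeft_smul, tensorLeft_one]
  have h2 : tensorRight (matV (A := A) (kMatrix ε γ h)) =
      (inV h : ℂ⟦X⟧⟦X⟧) • (tensorRight E + (C (C γ) * C X : ℂ⟦X⟧⟦X⟧) • 1) := by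
    rw [tensorRight_eq s, matV_kMatrix, tensorLeft_smul, tensorLeft_add, tensorLeft_smul,
      tensorLeft_one, tensorRight_eq s, ← hE]
    simp only [mul_smul_comm, smul_mul_assoc, mul_add, add_mul, mul_one, superSwap_mul_self]
  have key := reflection_involution (P := superSwap s A⟦X⟧⟦X⟧) (E₁ := tensorLeft s E)
    (E₂ := tensorRight E) (d := (C X - X : ℂ⟦X⟧⟦X⟧)) (d' := C X + X) (c := X * C X) (x := X)
    (y := C X) (g := C (C γ)) rfl rfl rfl (superSwap_mul_self s) (superSwap_mul_tensorLeft s E)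
    (superSwap_mul_tensorRight s E) (by rw [← tensorLeft_mul, hEE, tensorLeft_one])
    (by rw [← tensorRight_mul, hEE, tensorRight_one])
    (tensorLeft_diagonal_comm _ _ fun a p q => Int.cast_commute _ _).symm
  rw [h1, h2, rMinus, rPlus]
  simp only [mul_smul_comm, smul_mul_assoc] at key ⊢
  rw [key, smul_comm]

variable {S : Matrix (Fin k) (Fin k) A⟦X⟧}

/-- `T(u) K(u) T(-u)⁻¹` satisfies the reflection equation. -/
theorem IsRTT.dressed_reflection (hT : IsRTT s T) (hTS : T * S = 1) (hST : S * T = 1)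
    (ε : Fin k → ℤˣ) (γ : ℂ) (h : ℂ⟦X⟧) :
    rMinus s A * tensorLeft s (matU (dressed T S ε γ h)) * rPlus s A *
        tensorRight (matV (dressed T S ε γ h)) =
      tensorRight (matV (dressed T S ε γ h)) * rPlus s A *
        tensorLeft s (matU (dressed T S ε γ h)) * rMinus s A := by
  have hK : ∀ (a p q : Fin k) (f : ℂ⟦X⟧) (M : Matrix (Fin k) (Fin k) A⟦X⟧),
      Commute (inU (f • (1 : A⟦X⟧))) (inV (M p q)) ∧
      Commute (inV (f • (1 : A⟦X⟧))) (inU (M p q)) := by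
    intro a p q f M
    simp only [inU_smul, inV_smul, map_one]
    exact ⟨(Commute.one_left _).smul_left _, (Commute.one_left _).smul_left _⟩
  have hUd : ∀ D : Fin k → A⟦X⟧, matU (Matrix.diagonal D) = Matrix.diagonal fun a => inU (D a) :=
    fun D => by rw [matU, RingHom.mapMatrix_apply, Matrix.diagonal_map (map_zero _)]
  have hVd : ∀ D : Fin k → A⟦X⟧, matV (Matrix.diagonal D) = Matrix.diagonal fun a => inV (D a) :=
    fun D => by rw [matV, RingHom.mapMatrix_apply, Matrix.diagonal_map (map_zero _)]
  have key := reflection_dressed (R := rMinus s A) (R' := rPlus s A)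
    (X₁ := tensorLeft s (matU T)) (X₁' := tensorLeft s (matU (matNeg T)))
    (Y₁' := tensorLeft s (matU (matNeg S))) (W₂ := tensorRight (matV T))
    (W₂' := tensorRight (matV (matNeg T))) (V₂' := tensorRight (matV (matNeg S)))
    (K₁ := tensorLeft s (matU (kMatrix ε γ h))) (K₂ := tensorRight (matV (kMatrix ε γ h)))
    hT.rtt_u_v hT.rtt_u_neg_v (rtt_flip superSwap_mul_rPlus hT.rtt_v_neg_u)
    (rtt_flip superSwap_mul_rMinus hT.rtt_neg_v_neg_u)
    (by rw [← tensorLeft_mul, ← map_mul, ← map_mul, hTS, map_one, map_one, tensorLeft_one])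
    (by rw [← tensorLeft_mul, ← map_mul, ← map_mul, hST, map_one, map_one, tensorLeft_one])
    (by rw [← tensorRight_mul, ← map_mul, ← map_mul, hTS, map_one, map_one, tensorRight_one])
    (by rw [← tensorRight_mul, ← map_mul, ← map_mul, hST, map_one, map_one, tensorRight_one])
    (kMatrix_reflection ε γ h)
    (by rw [kMatrix, hUd]; exact tensorLeft_diagonal_comm _ _ fun a p q => (hK a p q _ T).1)
    (by rw [kMatrix, hVd]
        exact tensorLeft_comm_diagonal _ _ fun a p q => (hK a p q _ (matNeg S)).2)
    (by rw [kMatrix, hVd]; exact tensorLeft_comm_diagonal _ _ fun a p q => (hK a p q _ T).2)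
    (by rw [kMatrix, hUd]
        exact tensorLeft_diagonal_comm _ _ fun a p q => (hK a p q _ (matNeg S)).1)
  simpa only [dressed, map_mul, tensorLeft_mul, tensorRight_mul] using key

/-- The coefficients of the reflection equation, in the form of the defining relations of the
twisted super Yangian. -/
theorem IsRTT.dressed_reflection_series (hT : IsRTT s T) (hTS : T * S = 1) (hST : S * T = 1)
    (ε : Fin k → ℤˣ) (γ : ℂ) (h : ℂ⟦X⟧) (i j p q : Fin k) (m n : ℤ) :
    letI b : Fin k → Fin k → ℤ → A := fun i j n => zcoeff n (dressed T S ε γ h i j)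
    letI bb : Fin k → Fin k → ℤ → ℤ → A := fun i j m n => ∑ a, b i a m * b a j n
    superComm s i j p q (b i j (m + 2)) (b p q n) - superComm s i j p q (b i j m) (b p q (n + 2)) =
      sign3 s i j p • ((b p j (m + 1) * b i q n - b p j n * b i q (m + 1)) +
          (b p j m * b i q (n + 1) - b p j (n + 1) * b i q m)) +
        sign3 s i j p • (((if p = j then bb i q (m + 1) n else 0) -
            (if i = q then bb p j n (m + 1) else 0)) -
          ((if p = j then bb i q m (n + 1) else 0) - (if i = q then bb p j (n + 1) m else 0))) -
        (if i = j then bb p q m n - bb p q n m else 0) := by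
  have key := reflection_components s
    (hT.dressed_reflection hTS hST ε γ h) i j p q
  have hz : ∀ (m n : ℤ) (P : Prop) [Decidable P] (F : A⟦X⟧⟦X⟧),
      zcoeff₂ m n (if P then F else 0) = if P then zcoeff₂ m n F else 0 := by
    intro m n P _ F
    split_ifs
    · rfl
    · simp [zcoeff₂, zcoeff]
  have hsum : ∀ (m n : ℤ) (F : Fin k → A⟦X⟧⟦X⟧),
      zcoeff₂ m n (∑ a, F a) = ∑ a, zcoeff₂ m n (F a) := fun m n F =>
    map_sum (AddMonoidHom.mk' (zcoeff₂ m n) (zcoeff₂_add m n)) F _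
  have hUV : ∀ i j m n, zcoeff₂ m n ((matU (dressed T S ε γ h) * matV (dressed T S ε γ h)) i j) =
      ∑ a, zcoeff m (dressed T S ε γ h i a) * zcoeff n (dressed T S ε γ h a j) := by
    intro i j m n
    rw [Matrix.mul_apply, hsum]
    exact Finset.sum_congr rfl fun a _ => zcoeff₂_inU_mul_inV _ _ _ _
  have hVU : ∀ i j m n, zcoeff₂ m n ((matV (dressed T S ε γ h) * matU (dressed T S ε γ h)) i j) =
      ∑ a, zcoeff n (dressed T S ε γ h i a) * zcoeff m (dressed T S ε γ h a j) := by
    intro i j m n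
    rw [Matrix.mul_apply, hsum]
    exact Finset.sum_congr rfl fun a _ => zcoeff₂_inV_mul_inU _ _ _ _
  have hU : ∀ i j, matU (dressed T S ε γ h) i j = inU (dressed T S ε γ h i j) := fun _ _ => rfl
  have hV : ∀ i j, matV (dressed T S ε γ h) i j = inV (dressed T S ε γ h i j) := fun _ _ => rfl
  have key := congrArg (zcoeff₂ (m + 2) (n + 2)) key
  rw [show (C X - X : ℂ⟦X⟧⟦X⟧) * (C X + X) = C X * C X - X * X by ring] at key
  have e1 : m + 2 - 1 = m + 1 := by ring
  have e2 : n + 2 - 1 = n + 1 := by ring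
  simp only [mul_add, mul_sub, add_smul, sub_smul, mul_smul, zcoeff₂_add, zcoeff₂_sub,
    zcoeff₂_C_X_smul, zcoeff₂_X_smul, zcoeff₂_zsmul, hz, hUV, hVU, hU, hV, zcoeff₂_inU_mul_inV,
    zcoeff₂_inV_mul_inU, e1, e2, add_sub_cancel_right, smul_sub] at key
  simp only [superComm_eq, sign3_smul]
  linear_combination (norm := module) key

end Relations

section Homomorphism

open PowerSeries

variable {k : ℕ} {s ε : Fin k → ℤˣ} {A : Type*} [Ring A] [Algebra ℂ A]

theorem map_superComm {A' : Type*} [Ring A'] [Algebra ℂ A'] (φ : A →ₐ[ℂ] A') (i j p q : Fin k)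
    (x y : A) : φ (superComm s i j p q x y) = superComm s i j p q (φ x) (φ y) := by
  simp only [superComm, map_sub, map_mul, map_smul]

/-- The image of the matrix `(t_{ij}(u))` under a homomorphism from the super Yangian. -/
noncomputable def tSeries (f : Y s →ₐ[ℂ] A) : Matrix (Fin k) (Fin k) A⟦X⟧ :=
  Matrix.of fun i j => mk fun n => f (t s i j n)

theorem zcoeff_tSeries (f : Y s →ₐ[ℂ] A) (i j : Fin k) (n : ℤ) :
    zcoeff n (tSeries f i j) = f (t s i j n) := by
  rcases n with n | n
  · rw [Int.ofNat_eq_natCast, zcoeff_natCast, tSeries, Matrix.of_apply, coeff_mk]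
  · rw [zcoeff_of_neg (Int.negSucc_lt_zero n), t, tFree, seriesCoeff, map_zero, map_zero]

theorem isRTT_tSeries (f : Y s →ₐ[ℂ] A) : IsRTT s (tSeries f) := by
  intro i j p q m n
  simp only [zcoeff_tSeries]
  have h := congrArg f (RingQuot.mkAlgHom_rel ℂ (YRel.comm (s := s) i j p q m n))
  simpa only [t, map_sub, map_smul, map_mul, map_superComm] using h

theorem tSeries_constantCoeff (f : Y s →ₐ[ℂ] A) : (tSeries f).map constantCoeff = 1 := by
  ext i j
  rw [Matrix.map_apply, ← coeff_zero_eq_constantCoeff_apply, tSeries, Matrix.of_apply, coeff_mk, t]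
  have : tFree i j ((0 : ℕ) : ℤ) = if i = j then (1 : Free k) else 0 := rfl
  rw [this, Matrix.one_apply]
  split_ifs <;> simp

variable {T S : Matrix (Fin k) (Fin k) A⟦X⟧} {γ : ℂ} {h : ℂ⟦X⟧}

theorem dressed_constantCoeff (hT : T.map constantCoeff = 1) (hS : S.map constantCoeff = 1)
    (hh : constantCoeff h = 1) (i j : Fin k) :
    constantCoeff (dressed T S ε γ h i j) = if i = j then ((ε i : ℤ) : A) else 0 := by
  have hneg : (matNeg S).map constantCoeff = 1 := by
    rw [← hS]
    ext i j
    rw [Matrix.map_apply, Matrix.map_apply, matNeg, RingHom.mapMatrix_apply, Matrix.map_apply,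
      ← coeff_zero_eq_constantCoeff_apply, coeff_negX, pow_zero, one_smul,
      coeff_zero_eq_constantCoeff_apply]
  have hK : (kMatrix (A := A) ε γ h).map constantCoeff =
      Matrix.diagonal fun a => ((ε a : ℤ) : A) := by
    rw [kMatrix, Matrix.diagonal_map (map_zero _)]
    congr 1
    funext a
    have h0 : coeff 0 (h * (C ((ε a : ℤ) : ℂ) + C γ * X)) = ((ε a : ℤ) : ℂ) := by simp [hh]
    rw [← map_one (C (R := A)), ← coeff_zero_eq_constantCoeff_apply, series_smul_C, h0,
      Int.cast_smul_eq_zsmul, zsmul_one]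
  have : (dressed T S ε γ h).map constantCoeff = Matrix.diagonal fun a => ((ε a : ℤ) : A) := by
    rw [← RingHom.mapMatrix_apply] at hneg hK hT ⊢
    rw [dressed, map_mul, map_mul, hT, hneg, hK, one_mul, mul_one]
  rw [← Matrix.map_apply (f := constantCoeff), this, Matrix.diagonal_apply]

theorem dressed_mul_neg (hTS : T * S = 1) (hST : S * T = 1)
    (hh : h * negX h * (1 - C (γ ^ 2) * X ^ 2) = 1) :
    dressed T S ε γ h * matNeg (dressed T S ε γ h) = 1 := by
  have hnn : matNeg (matNeg S) = S := by
    ext1 i j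
    exact negX_negX _
  have hK : kMatrix (A := A) ε γ h * matNeg (kMatrix ε γ h) = 1 := by
    rw [kMatrix, matNeg, RingHom.mapMatrix_apply, Matrix.diagonal_map (map_zero _),
      Matrix.diagonal_mul_diagonal, ← Matrix.diagonal_one]
    congr 1
    funext a
    rw [negX_smul, map_one, smul_mul_smul_comm, one_mul, map_mul, map_add, map_mul, negX_C, negX_C,
      negX_X]
    have : h * (C ((ε a : ℤ) : ℂ) + C γ * X) * (negX h * (C ((ε a : ℤ) : ℂ) + C γ * -X)) = 1 := by
      have hε : (C ((ε a : ℤ) : ℂ) : ℂ⟦X⟧) * C ((ε a : ℤ) : ℂ) = 1 := by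
        rw [← map_mul]
        rcases Int.units_eq_one_or (ε a) with h | h <;> simp [h]
      rw [map_pow] at hh
      linear_combination hh + h * negX h * hε
    rw [this, one_smul]
  rw [dressed, map_mul, map_mul, hnn]
  calc T * kMatrix ε γ h * matNeg S * (matNeg T * matNeg (kMatrix ε γ h) * S)
      = T * kMatrix ε γ h * (matNeg S * matNeg T) * matNeg (kMatrix ε γ h) * S := by
        simp only [mul_assoc]
    _ = T * (kMatrix ε γ h * matNeg (kMatrix ε γ h)) * S := by
        rw [← map_mul matNeg S, hST, map_one, mul_one]; simp only [mul_assoc]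
    _ = 1 := by rw [hK, mul_one, hTS]

/-- The homomorphism `b(u) ↦ T(u) K(u) T(-u)⁻¹` from the twisted super Yangian. -/
theorem exists_hom_dressed (hT : IsRTT s T) (hT0 : T.map constantCoeff = 1)
    (hS0 : S.map constantCoeff = 1) (hTS : T * S = 1) (hST : S * T = 1)
    (hh0 : constantCoeff h = 1) (hh : h * negX h * (1 - C (γ ^ 2) * X ^ 2) = 1) :
    ∃ φ : B s ε →ₐ[ℂ] A, ∀ i j (n : ℕ), φ (b s ε i j n) = coeff n (dressed T S ε γ h i j) := by
  set D := dressed T S ε γ h with hD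
  let φ₀ : Free k →ₐ[ℂ] A := FreeAlgebra.lift ℂ fun x => coeff (x.2.2 + 1) (D x.1 x.2.1)
  have hφ : ∀ i j (n : ℤ), φ₀ (bFree ε i j n) = zcoeff n (D i j) := by
    rintro i j ((_ | n) | n)
    · change φ₀ (if i = j then ((ε i : ℤ) : ℂ) • (1 : Free k) else 0) = zcoeff ((0 : ℕ) : ℤ) (D i j)
      rw [zcoeff_natCast, coeff_zero_eq_constantCoeff_apply, hD, dressed_constantCoeff hT0 hS0 hh0]
      split_ifs
      · rw [map_smul, map_one, Int.cast_smul_eq_zsmul, zsmul_one]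
      · exact map_zero _
    · change φ₀ (FreeAlgebra.ι ℂ (i, j, n)) = zcoeff ((n + 1 : ℕ) : ℤ) (D i j)
      rw [zcoeff_natCast]
      exact FreeAlgebra.lift_ι_apply _ _
    · rw [zcoeff_of_neg (Int.negSucc_lt_zero n), bFree, seriesCoeff, map_zero]
  have hbb : ∀ i j m n, φ₀ (bbFree ε i j m n) = ∑ a, zcoeff m (D i a) * zcoeff n (D a j) := by
    intro i j m n
    simp only [bbFree, map_sum, map_mul, hφ]
  have hite : ∀ (P : Prop) [Decidable P] (x : Free k),
      φ₀ (if P then x else 0) = if P then φ₀ x else 0 := by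
    intro P _ x; split_ifs <;> simp
  have hrel : ∀ ⦃x y⦄, BRel s ε x y → φ₀ x = φ₀ y := by
    rintro x y (⟨i, j, p, q, m, n⟩ | ⟨i, j, n⟩)
    · have := hT.dressed_reflection_series hTS hST ε γ h i j p q m n
      simp only [bSkewFree, bDeltaFree, map_sub, map_add, map_smul, map_mul, map_superComm, hφ,
        hbb, hite]
      exact this
    · have h1 := congrFun (congrFun (dressed_mul_neg (ε := ε) hTS hST hh) i) j
      have h2 := congrArg (coeff n) h1
      rw [Matrix.mul_apply, map_sum] at h2
      simp only [map_sum, map_smul, hbb, hite, map_one]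
      rw [show (if i = j ∧ n = 0 then (1 : A) else 0) =
        coeff n ((1 : Matrix (Fin k) (Fin k) A⟦X⟧) i j) by
          rw [Matrix.one_apply]
          by_cases hij : i = j <;> simp [hij, coeff_one], ← h2]
      simp only [Finset.smul_sum]
      rw [Finset.sum_comm]
      refine Finset.sum_congr rfl fun a _ => ?_
      rw [coeff_mul, Finset.Nat.sum_antidiagonal_eq_sum_range_succ_mk, ← Finset.sum_range_reflect]
      refine Finset.sum_congr rfl fun r hr => ?_
      have hr : r ≤ n := by simpa [Nat.lt_succ_iff] using hr
      have e1 : n + 1 - 1 - r = n - r := by omega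
      have e2 : (n : ℤ) - ((n - r : ℕ) : ℤ) = (r : ℕ) := by omega
      rw [e1, e2, zcoeff_natCast, zcoeff_natCast]
      change _ = coeff r (D i a) * coeff (n - r) (negX (D a j))
      rw [coeff_negX, mul_smul_comm, ← Int.cast_smul_eq_zsmul ℂ]
      push_cast
      rfl
  refine ⟨RingQuot.liftAlgHom ℂ ⟨φ₀, hrel⟩, fun i j n => ?_⟩
  rw [b, RingQuot.liftAlgHom_mkAlgHom_apply, hφ, zcoeff_natCast]

end Homomorphism

/-! ### Highest weight vectors for the twisted super Yangian -/

section Specialisation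

open PowerSeries

variable {A : Type*} [Ring A]

variable (A) in
/-- The specialization `v = -u`, as a ring homomorphism. -/
noncomputable def antidiagHom : A⟦X⟧⟦X⟧ →+* A⟦X⟧ where
  toFun := antidiag
  map_one' := by rw [← map_one inU, antidiag_inU]
  map_mul' := antidiag_mul
  map_zero' := antidiag_zero
  map_add' := antidiag_add

theorem antidiagHom_inU (f : A⟦X⟧) : antidiagHom A (inU f) = f := antidiag_inU f

theorem antidiagHom_inV (f : A⟦X⟧) : antidiagHom A (inV f) = negX f := antidiag_inV f

variable [Algebra ℂ A]

theorem antidiagHom_smul (f : ℂ⟦X⟧⟦X⟧) (F : A⟦X⟧⟦X⟧) :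
    antidiagHom A (f • F) = antidiagHom ℂ f • antidiagHom A F := antidiag_smul f F

/-- The series `(v + r)⁻¹`, expanded in `X = v⁻¹`. -/
noncomputable def shiftVar (r : ℤ) : ℂ⟦X⟧ := X * (1 + C (r : ℂ) * X)⁻¹

theorem one_add_mul_inv (r : ℤ) : (1 + C (r : ℂ) * X : ℂ⟦X⟧) * (1 + C (r : ℂ) * X)⁻¹ = 1 :=
  PowerSeries.mul_inv_cancel _ (by simp)

theorem constantCoeff_shiftVar (r : ℤ) : constantCoeff (shiftVar r) = 0 := by
  simp [shiftVar]

theorem negX_eq_subst (f : ℂ⟦X⟧) : negX f = f.subst ((-1 : ℂ) • X : ℂ⟦X⟧) := by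
  rw [← rescale_eq_subst]
  ext n
  rw [coeff_negX, coeff_rescale, zsmul_eq_mul]
  push_cast
  rfl

theorem negX_subst_shiftVar (r : ℤ) (f : ℂ⟦X⟧) :
    negX (f.subst (shiftVar r)) = reflectShift r f := by
  rw [negX_eq_subst, subst_comp_subst_apply
    (HasSubst.of_constantCoeff_zero' (constantCoeff_shiftVar r)) (HasSubst.smul_X' _),
    ← negX_eq_subst, reflectShift]
  congr 1
  rw [shiftVar, map_mul, negX_X, neg_mul]
  congr 2
  rw [PowerSeries.eq_inv_iff_mul_eq_one (by simp), mul_comm]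
  have := congrArg negX (one_add_mul_inv r)
  simpa only [map_mul, map_add, map_one, negX_C, negX_X, mul_neg, ← sub_eq_add_neg] using this

theorem sub_smul_eq_of_congr {Z M : Type*} [CommRing Z] [AddCommGroup M] [Module Z M]
    {f g a b p q Q Q' : Z} {w w' F : M} (hf : f = a + p * Q) (hg : g = b + p * Q')
    (h : f • w - g • w' = (p * q) • F) :
    a • w - b • w' = p • (q • F - Q • w + Q' • w') := by
  subst hf hg
  linear_combination (norm := module) h

/-- An equation modulo `u - v - r` remains true for `u = v + r`. -/
theorem subst_shiftVar_smul_eq {r : ℤ} {f g : ℂ⟦X⟧} {w w' : A⟦X⟧} {F : A⟦X⟧⟦X⟧}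
    (h : (inU f : ℂ⟦X⟧⟦X⟧) • inV w - (inU g : ℂ⟦X⟧⟦X⟧) • inV w' =
      ((C X - X : ℂ⟦X⟧⟦X⟧) - (r : ℂ⟦X⟧⟦X⟧) * (X * C X)) • F) :
    f.subst (shiftVar r) • w = g.subst (shiftVar r) • w' := by
  have hp := constantCoeff_shiftVar r
  obtain ⟨Q, hQ⟩ := exists_inU_eq_subst hp f
  obtain ⟨Q', hQ'⟩ := exists_inU_eq_subst hp g
  have hd : (C X - X : ℂ⟦X⟧⟦X⟧) - (r : ℂ⟦X⟧⟦X⟧) * (X * C X) =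
      (X - C (shiftVar r)) * -(1 + (r : ℂ⟦X⟧⟦X⟧) * C X) := by
    have : (1 + (r : ℂ⟦X⟧⟦X⟧) * C X) * C (shiftVar r) = C X := by
      rw [shiftVar, ← map_intCast (C (R := ℂ⟦X⟧)), ← map_mul, ← map_one (C (R := ℂ⟦X⟧)),
        ← map_add, ← map_mul]
      congr 1
      have h1 := one_add_mul_inv r
      rw [map_intCast] at h1 ⊢
      linear_combination X * h1
    linear_combination -this
  rw [← sub_eq_zero]
  rw [hd] at h
  have h := sub_smul_eq_of_congr hQ hQ' h
  rw [← inV_smul, ← inV_smul, ← map_sub] at h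
  exact eq_zero_of_inV_eq_smul hp h

end Specialisation

section HighestWeightSeries

open PowerSeries

variable {k : ℕ} {s ε : Fin k → ℤˣ} {A : Type*} [Ring A]
  {T S : Matrix (Fin k) (Fin k) A⟦X⟧} {e : A} {lam : Fin k → ℂ⟦X⟧}

theorem inU_C (a : A) : inU (C a) = inV (C a) := by simp [inU, inV]

theorem matU_mul_eq_zero (hup : ∀ i j, i < j → T i j * C e = 0) (i j : Fin k) (hij : i < j) :
    matU T i j * inU (C e) = 0 := by
  change inU (T i j) * inU (C e) = 0
  rw [← map_mul, hup i j hij, map_zero]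

theorem matV_mul_eq (i j : Fin k) : matV S i j * inU (C e) = inV (S i j * C e) := by
  rw [inU_C, map_mul]
  rfl

theorem matV_mul_eq_zero (hlow : ∀ i j, i < j → S i j * C e = 0) (i j : Fin k) (hij : i < j) :
    matV S i j * inU (C e) = 0 := by
  rw [matV_mul_eq, hlow i j hij, map_zero]

variable [Algebra ℂ A]

theorem IsRTT.mixed (hT : IsRTT s T) (hTS : T * S = 1) (hST : S * T = 1) (i j p q : Fin k) :
    (C X - X : ℂ⟦X⟧⟦X⟧) • (matU T i j * matV S p q -
        commSign s i j p q • (matV S p q * matU T i j)) =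
      (X * C X : ℂ⟦X⟧⟦X⟧) • tripleSign s i j p •
        ((if p = j then (matU T * matV S) i q else 0) -
          (if i = q then (matV S * matU T) p j else 0)) :=
  mixed_components s (mixed_of_rtt hT.rtt_u_v
    (by rw [← tensorRight_mul, ← map_mul, hTS, map_one, tensorRight_one])
    (by rw [← tensorRight_mul, ← map_mul, hST, map_one, tensorRight_one])) i j p q

theorem matU_mul_eq_smul (hdiag : ∀ i, T i i * C e = lam i • C e) (i : Fin k) :
    matU T i i * inU (C e) = (inU (lam i) : ℂ⟦X⟧⟦X⟧) • inU (C e) := by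
  change inU (T i i) * inU (C e) = _
  rw [← map_mul, hdiag, inU_smul]

theorem exists_matU_eq (T : Matrix (Fin k) (Fin k) A⟦X⟧) :
    ∃ τ, matU T = matV T + (C X - X : ℂ⟦X⟧⟦X⟧) • τ := by
  choose Q hQ using fun f : A⟦X⟧ => exists_inU_eq_inV_add (Z := ℂ) f
  refine ⟨T.map Q, ?_⟩
  ext1 i j
  exact hQ (T i j)

variable (hT : IsRTT s T) (hTS : T * S = 1) (hST : S * T = 1)
  (hup : ∀ i j, i < j → T i j * C e = 0) (hdiag : ∀ i, T i i * C e = lam i • C e)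

include hT hTS hST hup hdiag in
/-- `T(v)⁻¹` is triangular on a highest weight vector. -/
theorem inv_upper (hlam : ∀ i, constantCoeff (lam i) = 1) (i j : Fin k) (hij : i < j) :
    S i j * C e = 0 := by
  induction j using WellFoundedGT.induction with
  | ind j ih =>
  obtain ⟨τ, hτ⟩ := exists_matU_eq T
  obtain ⟨f, hf⟩ := exists_smul_inv_upper (hT.mixed hTS hST) eq_zero_of_sub_smul_eq_zero
    (matU_mul_eq_zero hup) (matU_mul_eq_smul hdiag) (by rw [← map_mul, hST, map_one]) hτ hij
    (fun a ha => by rw [matV_mul_eq, ih a ha (hij.trans ha), map_zero])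
  rw [matV_mul_eq] at hf
  have h := subst_shiftVar_smul_eq (g := 0) (w' := (0 : A⟦X⟧)) (F := f) (r := rhoInt s j)
    (f := lam j) (w := S i j * C e) (by rw [map_zero, zero_smul, sub_zero, hf])
  rw [smul_zero] at h
  have hc : constantCoeff ((lam j).subst (shiftVar (rhoInt s j))) ≠ 0 := by
    have := constantCoeff_subst_eq_zero (constantCoeff_shiftVar (rhoInt s j)) (lam j - C 1)
      (by simp [hlam])
    rw [subst_sub (HasSubst.of_constantCoeff_zero' (constantCoeff_shiftVar _)), subst_C] at this
    replace this : constantCoeff ((lam j).subst (shiftVar (rhoInt s j)) - C 1) = 0 := this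
    rw [map_sub, constantCoeff_C, sub_eq_zero] at this
    rw [this]; exact one_ne_zero
  have h2 := congrArg (fun x => ((lam j).subst (shiftVar (rhoInt s j)))⁻¹ • x) h
  rwa [smul_zero, smul_smul, PowerSeries.inv_mul_cancel _ hc, one_smul] at h2

variable (hlow : ∀ i j, i < j → S i j * C e = 0)

include hT hTS hST hup hdiag hlow in
/-- The identity `λ_i(-u + ρ) t'_{ii}(-u) = λ_j(-u + ρ) t'_{jj}(-u)` on a highest weight vector,
with `j = i + 1`, `ρ = ρ_{i+1}` and `t'_{ii}` the diagonal entries of the inverse matrix. -/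
theorem inv_diag_shift {i j : Fin k} (hij : (j : ℕ) = i + 1) :
    reflectShift (rhoInt s i : ℂ) (lam i) • (negX (S i i) * C e) =
      reflectShift (rhoInt s i : ℂ) (lam j) • (negX (S j j) * C e) := by
  obtain ⟨τ, hτ⟩ := exists_matU_eq T
  obtain ⟨f, hf⟩ := exists_smul_inv_diag (hT.mixed hTS hST) eq_zero_of_sub_smul_eq_zero
    (matU_mul_eq_zero hup) (matU_mul_eq_smul hdiag) (by rw [← map_mul, hST, map_one]) hτ
    (matV_mul_eq_zero hlow) hij
  rw [matV_mul_eq, matV_mul_eq] at hf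
  have h := congrArg negX (subst_shiftVar_smul_eq hf)
  rw [negX_smul, negX_smul, negX_subst_shiftVar, negX_subst_shiftVar, map_mul, map_mul,
    negX_C] at h
  exact h

include hST hup hdiag in
theorem inv_diag_last {i : Fin k} (hi : ∀ a, a ≤ i) :
    negX (lam i) • (negX (S i i) * C e) = C e := by
  have h := congrArg (fun M : Matrix (Fin k) (Fin k) A⟦X⟧ => M i i * C e) hST
  simp only [Matrix.mul_apply, Matrix.one_apply_eq, one_mul, Finset.sum_mul] at h
  rw [Finset.sum_eq_single i, mul_assoc, hdiag, mul_smul_comm] at h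
  · have h := congrArg negX h
    rwa [negX_smul, map_mul, negX_C] at h
  · intro a _ ha
    rw [mul_assoc, hup a i (lt_of_le_of_ne (hi a) ha), mul_zero]
  · simp

variable {γ : ℂ} {h : ℂ⟦X⟧}

theorem dressed_apply (i j : Fin k) : dressed T S ε γ h i j =
    ∑ a, (h * (C ((ε a : ℤ) : ℂ) + C γ * X)) • (T i a * negX (S a j)) := by
  rw [dressed, kMatrix, Matrix.mul_apply]
  refine Finset.sum_congr rfl fun a _ => ?_
  rw [Matrix.mul_diagonal, mul_smul_comm, mul_one, smul_mul_assoc]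
  rfl

include hT hTS hST hup hlow in
theorem dressed_upper {i j : Fin k} (hij : i < j) : dressed T S ε γ h i j * C e = 0 := by
  rw [dressed_apply, Finset.sum_mul]
  refine Finset.sum_eq_zero fun a _ => ?_
  have h := congrArg (antidiagHom A) (upper_mul_inv (hT.mixed hTS hST)
    eq_zero_of_sub_smul_eq_zero (matU_mul_eq_zero hup) (matV_mul_eq_zero hlow) hij a)
  rw [map_mul, map_mul, map_zero, antidiagHom_inU] at h
  change antidiagHom A (inU (T i a)) * antidiagHom A (inV (S a j)) * _ = 0 at h
  rw [antidiagHom_inU, antidiagHom_inV] at h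
  rw [smul_mul_assoc, h, smul_zero]

theorem semilinear_apply {Z₁ Z₂ M₁ M₂ ι : Type*} [CommRing Z₁] [CommRing Z₂] [AddCommGroup M₁]
    [AddCommGroup M₂] [Module Z₁ M₁] [Module Z₂ M₂] (ψ : Z₁ →+* Z₂) (φ : M₁ →ₛₗ[ψ] M₂)
    {I : Finset ι} {d c κ l : Z₁} {z : ι → Z₁} {M : ι → M₁} {m w : M₁}
    (h : d • m + c • ∑ b ∈ I, z b • M b = κ • l • w) :
    ψ d • φ m + ψ c • ∑ b ∈ I, ψ (z b) • φ (M b) = ψ κ • ψ l • φ w := by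
  have h := congrArg φ h
  simpa only [map_add, map_sum, LinearMap.map_smulₛₗ] using h

variable (A) in
/-- The specialization `v = -u`, as a semilinear map. -/
noncomputable def antidiagLin : A⟦X⟧⟦X⟧ →ₛₗ[antidiagHom ℂ] A⟦X⟧ where
  toFun := antidiag
  map_add' := antidiag_add
  map_smul' := antidiag_smul

theorem antidiagHom_X : antidiagHom ℂ X = X := by
  have := antidiagHom_inU (X : ℂ⟦X⟧)
  rwa [inU, map_X] at this

theorem antidiagHom_C_X : antidiagHom ℂ (C X) = -X := by
  have := antidiagHom_inV (X : ℂ⟦X⟧)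
  rwa [negX_X] at this

theorem antidiagHom_dressed (κ : Fin k → ℂ⟦X⟧) (i : Fin k) :
    antidiagHom A (∑ a, (inU (κ a) : ℂ⟦X⟧⟦X⟧) • (matU T i a * matV S a i * inU (C e))) =
      ∑ a, κ a • (T i a * negX (S a i) * C e) := by
  rw [map_sum]
  refine Finset.sum_congr rfl fun a _ => ?_
  rw [antidiagHom_smul, map_mul, map_mul, antidiagHom_inU, antidiagHom_inU]
  congr 3
  · exact antidiagHom_inU _
  · exact antidiagHom_inV _

include hT hTS hST hup hdiag hlow in
/-- The specialization of `dressed_diag` at `v = -u`, with a factor `u` removed. -/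
theorem dressed_diag_series (i : Fin k) :
    (2 - C (rhoInt s i : ℂ) * X : ℂ⟦X⟧) • (dressed T S ε γ h i i * C e) +
      (X : ℂ⟦X⟧) • ∑ a ∈ Finset.Ioi i,
        (C ((s a : ℤ) : ℂ) : ℂ⟦X⟧) • (dressed T S ε γ h a a * C e) =
    (h * (2 * C ((ε i : ℤ) : ℂ) + C (-((ε i : ℤ) * rhoInt s i) +
        ∑ a ∈ Finset.Ioi i, ((ε a : ℤ) : ℂ) * ((s a : ℤ) : ℂ) + 2 * γ) * X) * lam i) •
      (negX (S i i) * C e) := by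
  obtain ⟨κ, hκ⟩ : ∃ κ : Fin k → ℂ⟦X⟧, ∀ a, κ a = h * (C ((ε a : ℤ) : ℂ) + C γ * X) :=
    ⟨_, fun _ => rfl⟩
  have key := semilinear_apply (antidiagHom ℂ) (antidiagLin A)
    (dressed_diag (hT.mixed hTS hST) eq_zero_of_sub_smul_eq_zero (matU_mul_eq_zero hup)
      (matU_mul_eq_smul hdiag) (matV_mul_eq_zero hlow) (fun a => inU (κ a)) i)
  have hM : ∀ i, antidiagLin A (∑ a, (inU (κ a) : ℂ⟦X⟧⟦X⟧) •
      (matU T i a * matV S a i * inU (C e))) = dressed T S ε γ h i i * C e := by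
    intro i
    rw [dressed_apply, Finset.sum_mul]
    simp only [smul_mul_assoc, ← hκ]
    exact antidiagHom_dressed κ i
  have hw : antidiagLin A (matV S i i * inU (C e)) = negX (S i i) * C e := by
    rw [matV_mul_eq, show negX (S i i) * C e = negX (S i i * C e) by rw [map_mul, negX_C]]
    exact antidiag_inV (S i i * C e)
  have h1 : antidiagHom ℂ (C X - X - (rhoInt s i : ℂ⟦X⟧⟦X⟧) * (X * C X)) =
      -X * (2 - C (rhoInt s i : ℂ) * X) := by
    rw [map_sub, map_sub, map_mul, map_mul, map_intCast, antidiagHom_X, antidiagHom_C_X,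
      map_intCast]
    ring
  have h2 : antidiagHom ℂ (X * C X) = -X * X := by
    rw [map_mul, antidiagHom_X, antidiagHom_C_X]; ring
  have h3 : antidiagHom ℂ (inU (κ i) * (C X - X - (rhoInt s i : ℂ⟦X⟧⟦X⟧) * (X * C X)) +
      X * C X * ∑ a ∈ Finset.Ioi i, ((s a : ℤ) : ℂ⟦X⟧⟦X⟧) * inU (κ a)) =
      -X * (h * (2 * C ((ε i : ℤ) : ℂ) + C (-((ε i : ℤ) * rhoInt s i) +
        ∑ a ∈ Finset.Ioi i, ((ε a : ℤ) : ℂ) * ((s a : ℤ) : ℂ) + 2 * γ) * X)) := by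
    have h4 : ∑ a ∈ Finset.Ioi i, ((s a : ℤ) : ℂ⟦X⟧) * κ a =
        h * (C (∑ a ∈ Finset.Ioi i, ((ε a : ℤ) : ℂ) * ((s a : ℤ) : ℂ)) +
          (rhoInt s i : ℂ⟦X⟧) * (C γ * X)) := by
      rw [rhoInt, Int.cast_sum, Finset.sum_mul, map_sum, ← Finset.sum_add_distrib, Finset.mul_sum]
      refine Finset.sum_congr rfl fun a _ => ?_
      simp only [hκ, map_mul, map_intCast]
      ring
    rw [map_add, map_mul, h1, map_mul _ (X * C X), h2, map_sum]
    simp only [map_mul, antidiagHom_inU, map_intCast (antidiagHom ℂ)]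
    rw [h4, hκ]
    simp only [map_add, map_neg, map_mul, map_intCast, map_ofNat]
    ring
  rw [hM, hw, h1, h2, h3, antidiagHom_inU] at key
  simp only [hM, map_intCast] at key
  simp only [map_intCast] at key ⊢
  -- `u⁻¹ v⁻¹ (u - v - ρ)` specializes to `-u⁻¹ (2 - ρ u⁻¹)`; the common factor `-u⁻¹` is cancelled
  apply X_mul_cancel
  rw [← X_smul_series (Z := ℂ), ← X_smul_series (Z := ℂ), ← neg_inj]
  simp only [mul_smul, neg_smul] at key
  rw [smul_add, neg_add, key]
  simp only [mul_smul]

end HighestWeightSeries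

/-! ### Comparison of highest weights -/

section Weights

open PowerSeries

variable {k : ℕ} {s ε : Fin k → ℤˣ}

/-- The series `u⁻¹ ((2u - ρ_{i+1}) μ_i(u) + ∑_{a > i} s_a μ_a(u))`, in `X = u⁻¹`. -/
noncomputable def muHat (s : Fin k → ℤˣ) (μ : Fin k → ℂ⟦X⟧) (i : Fin k) : ℂ⟦X⟧ :=
  (2 - C (rhoInt s i : ℂ) * X) * μ i + X * ∑ a ∈ Finset.Ioi i, C ((s a : ℤ) : ℂ) * μ a

/-- The series `u⁻¹ (2 ε_i u - ε_i ρ_{i+1} + ϖ_{i+1} + 2 γ)`, in `X = u⁻¹`. -/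
noncomputable def linHat (s ε : Fin k → ℤˣ) (γ : ℂ) (i : Fin k) : ℂ⟦X⟧ :=
  2 * C ((ε i : ℤ) : ℂ) + C (-((ε i : ℤ) * rhoInt s i) +
    ∑ a ∈ Finset.Ioi i, ((ε a : ℤ) : ℂ) * ((s a : ℤ) : ℂ) + 2 * γ) * X

theorem filter_lt_eq_Ioi (i : Fin k) : Finset.univ.filter (fun a => i < a) = Finset.Ioi i := by
  ext a; simp

theorem rhoSucc_eq (s : Fin k → ℤˣ) (i : Fin k) : rhoSucc s i = (rhoInt s i : ℂ) := by
  rw [rhoSucc, rhoInt, filter_lt_eq_Ioi, Int.cast_sum]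

theorem u_mul_toLaurent_X : u * toLaurent X = 1 := by
  rw [u, toLaurent, HahnSeries.ofPowerSeries_X, HahnSeries.single_mul_single]
  simp

theorem toLaurent_C (c : ℂ) : toLaurent (C c) = cst c := HahnSeries.ofPowerSeries_C c

theorem toLaurent_mul (f g : ℂ⟦X⟧) : toLaurent (f * g) = toLaurent f * toLaurent g :=
  map_mul (HahnSeries.ofPowerSeries ℤ ℂ) f g

theorem toLaurent_add (f g : ℂ⟦X⟧) : toLaurent (f + g) = toLaurent f + toLaurent g :=
  map_add (HahnSeries.ofPowerSeries ℤ ℂ) f g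

theorem toLaurent_sub (f g : ℂ⟦X⟧) : toLaurent (f - g) = toLaurent f - toLaurent g :=
  map_sub (HahnSeries.ofPowerSeries ℤ ℂ) f g

theorem toLaurent_sum {ι : Type*} (I : Finset ι) (f : ι → ℂ⟦X⟧) :
    toLaurent (∑ a ∈ I, f a) = ∑ a ∈ I, toLaurent (f a) :=
  map_sum (HahnSeries.ofPowerSeries ℤ ℂ) f I

theorem toLaurent_two : toLaurent 2 = 2 := map_ofNat (HahnSeries.ofPowerSeries ℤ ℂ) 2

theorem toLaurent_injective : Function.Injective toLaurent := HahnSeries.ofPowerSeries_injective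

theorem toLaurent_ne_zero {f : ℂ⟦X⟧} (hf : constantCoeff f ≠ 0) : toLaurent f ≠ 0 := by
  intro h
  have h0 : f = 0 := toLaurent_injective (h.trans (map_zero (HahnSeries.ofPowerSeries ℤ ℂ)).symm)
  exact hf (by rw [h0, map_zero])

theorem u_ne_zero : u ≠ 0 := left_ne_zero_of_mul (u_mul_toLaurent_X ▸ one_ne_zero)

theorem muTilde_eq (s : Fin k → ℤˣ) (μ : Fin k → ℂ⟦X⟧) (i : Fin k) :
    muTilde s μ i = u * toLaurent (muHat s μ i) := by
  rw [muTilde, muHat, filter_lt_eq_Ioi, rhoSucc_eq]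
  simp only [toLaurent_add, toLaurent_mul, toLaurent_sub, toLaurent_two, toLaurent_sum,
    toLaurent_C]
  linear_combination (cst (rhoInt s i : ℂ) * toLaurent (μ i) -
    ∑ a ∈ Finset.Ioi i, cst ((s a : ℤ) : ℂ) * toLaurent (μ a)) * u_mul_toLaurent_X

theorem linFactor_eq (s ε : Fin k → ℤˣ) (γ : ℂ) (i : Fin k) :
    linFactor s ε γ i = u * toLaurent (linHat s ε γ i) := by
  have h2 : cst (2 * γ) = 2 * cst γ := by
    rw [cst, map_mul, map_ofNat]
    rfl
  have h : cst (-((ε i : ℤ) * rhoInt s i) +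
      ∑ a ∈ Finset.Ioi i, ((ε a : ℤ) : ℂ) * ((s a : ℤ) : ℂ) + 2 * γ) =
      -cst ((ε i : ℤ) * rhoInt s i) + cst (varpiSucc s ε i) + 2 * cst γ := by
    rw [← h2, varpiSucc, filter_lt_eq_Ioi]
    simp only [cst, map_add, map_neg]
  rw [linFactor, linHat, rhoSucc_eq]
  simp only [toLaurent_add, toLaurent_mul, toLaurent_two, toLaurent_C, h]
  linear_combination (cst ((ε i : ℤ) * rhoInt s i) - cst (varpiSucc s ε i) - 2 * cst γ) *
    u_mul_toLaurent_X

theorem sign_ne_zero (x : ℤˣ) : ((x : ℤ) : ℂ) ≠ 0 := Int.cast_ne_zero.2 x.ne_zero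

theorem sign_mul_self (x : ℤˣ) : ((x : ℤ) : ℂ) * ((x : ℤ) : ℂ) = 1 := by
  rw [← Int.cast_mul, ← Units.val_mul, Int.units_mul_self, Units.val_one, Int.cast_one]

theorem constantCoeff_linHat_ne_zero (γ : ℂ) (i : Fin k) :
    constantCoeff (linHat s ε γ i) ≠ 0 := by
  simp [linHat, map_ofNat constantCoeff]

theorem constantCoeff_muHat_ne_zero {μ : Fin k → ℂ⟦X⟧}
    (hμ : ∀ i, constantCoeff (μ i) = ((ε i : ℤ) : ℂ)) (i : Fin k) :
    constantCoeff (muHat s μ i) ≠ 0 := by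
  simp [muHat, hμ, map_ofNat constantCoeff]

theorem constantCoeff_reflectShift {f : ℂ⟦X⟧} {c d : ℂ} (hf : constantCoeff f = d) :
    constantCoeff (reflectShift c f) = d := by
  set p : ℂ⟦X⟧ := -(X * (1 - C c * X)⁻¹) with hp
  have hp0 : constantCoeff p = 0 := by simp [hp]
  have h : constantCoeff ((f - C d).subst p) = 0 :=
    constantCoeff_subst_eq_zero hp0 (f - C d) (by simp [hf])
  rw [subst_sub (HasSubst.of_constantCoeff_zero' hp0), subst_C] at h
  replace h : constantCoeff (f.subst p - C d) = 0 := h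
  rwa [map_sub, constantCoeff_C, sub_eq_zero] at h

/-- The hypothesis on quotients of weights, as an identity of power series in `u⁻¹`. -/
theorem muHat_mul_eq {μ lam : Fin k → ℂ⟦X⟧} {γ : ℂ}
    (hμ : ∀ i, constantCoeff (μ i) = ((ε i : ℤ) : ℂ)) (hlam : ∀ i, constantCoeff (lam i) = 1)
    {i j : Fin k}
    (h : muTilde s μ i / muTilde s μ j =
        (linFactor s ε γ i * toLaurent (lam i) * toLaurent (reflectShift (rhoSucc s i) (lam j))) /
        (linFactor s ε γ j * toLaurent (lam j) *
          toLaurent (reflectShift (rhoSucc s i) (lam i)))) :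
    muHat s μ i * (linHat s ε γ j * lam j * reflectShift (rhoInt s i : ℂ) (lam i)) =
      muHat s μ j * (linHat s ε γ i * lam i * reflectShift (rhoInt s i : ℂ) (lam j)) := by
  have hl : ∀ a, toLaurent (lam a) ≠ 0 := fun a =>
    toLaurent_ne_zero (by rw [hlam]; exact one_ne_zero)
  have hr : toLaurent (reflectShift (rhoInt s i : ℂ) (lam i)) ≠ 0 :=
    toLaurent_ne_zero (by rw [constantCoeff_reflectShift (hlam i)]; exact one_ne_zero)
  rw [muTilde_eq, muTilde_eq, linFactor_eq, linFactor_eq, rhoSucc_eq, div_eq_div_iff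
    (mul_ne_zero u_ne_zero (toLaurent_ne_zero (constantCoeff_muHat_ne_zero hμ j)))
    (mul_ne_zero (mul_ne_zero (mul_ne_zero u_ne_zero
      (toLaurent_ne_zero (constantCoeff_linHat_ne_zero γ j))) (hl j)) hr)] at h
  apply toLaurent_injective
  simp only [toLaurent_mul]
  apply mul_left_cancel₀ (mul_ne_zero u_ne_zero u_ne_zero)
  linear_combination h

theorem smul_cancel_of_constantCoeff_ne_zero {M : Type*} [AddCommGroup M] [Module ℂ⟦X⟧ M]
    {f : ℂ⟦X⟧} (hf : constantCoeff f ≠ 0) {x y : M} (h : f • x = f • y) : x = y := by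
  have h := congrArg (f⁻¹ • ·) h
  simpa only [smul_smul, PowerSeries.inv_mul_cancel _ hf, one_smul] using h

theorem smul_eq_of_ratio {Z M : Type*} [CommRing Z] [AddCommGroup M] [Module Z M]
    {m m' l l' p p' r r' h : Z} {x w w' : M} (h1 : m * (l' * p' * r) = m' * (l * p * r'))
    (h2 : m' • x = (h * l' * p') • w') (h3 : r • w = r' • w') :
    (l' * p' * r) • m • x = (l' * p' * r) • (h * l * p) • w := by
  have h1 := congrArg (· • x) h1
  linear_combination (norm := module) h1 + (l * p * r') • h2 - (h * l * p * l' * p') • h3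

/-- Solves the recursion for the weights of the twisted super Yangian: `d i` are the eigenvectors
of its diagonal series, `w i` those of `T(-u)⁻¹`. -/
theorem eq_smul_of_recursion {M : Type*} [AddCommGroup M] [Module ℂ⟦X⟧ M] {x : M}
    {d w : Fin k → M} {μ lam : Fin k → ℂ⟦X⟧} {γ : ℂ} {h : ℂ⟦X⟧}
    (hlam : ∀ i, constantCoeff (lam i) = 1)
    (hratio : ∀ i j : Fin k, (j : ℕ) = i + 1 →
      muHat s μ i * (linHat s ε γ j * lam j * reflectShift (rhoInt s i : ℂ) (lam i)) =
        muHat s μ j * (linHat s ε γ i * lam i * reflectShift (rhoInt s i : ℂ) (lam j)))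
    (hh : ∀ i : Fin k, (∀ a, a ≤ i) →
      μ i * negX (lam i) = h * (C ((ε i : ℤ) : ℂ) + C γ * X) * lam i)
    (hlast : ∀ i : Fin k, (∀ a, a ≤ i) → negX (lam i) • w i = x)
    (hshift : ∀ i j : Fin k, (j : ℕ) = i + 1 → reflectShift (rhoInt s i : ℂ) (lam i) • w i =
      reflectShift (rhoInt s i : ℂ) (lam j) • w j)
    (hd : ∀ i, (2 - C (rhoInt s i : ℂ) * X : ℂ⟦X⟧) • d i +
      (X : ℂ⟦X⟧) • ∑ a ∈ Finset.Ioi i, (C ((s a : ℤ) : ℂ) : ℂ⟦X⟧) • d a =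
        (h * linHat s ε γ i * lam i) • w i) (i : Fin k) :
    d i = μ i • x := by
  have key : ∀ i, muHat s μ i • x = (h * linHat s ε γ i * lam i) • w i := by
    intro i
    induction i using WellFoundedGT.induction with
    | ind i ih =>
    by_cases hi : ∀ a, a ≤ i
    · have hI : Finset.Ioi i = ∅ := by
        ext a; simpa using hi a
      rw [← hlast i hi, smul_smul]
      congr 1
      rw [muHat, linHat, rhoInt, hI]
      simp only [Finset.sum_empty, Int.cast_zero, map_zero, mul_zero, neg_zero, zero_add,
        map_mul, map_ofNat]
      linear_combination 2 * hh i hi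
    · push Not at hi
      obtain ⟨a, ha⟩ := hi
      have hlt : (i : ℕ) + 1 < k := lt_of_le_of_lt (Nat.succ_le_of_lt ha) a.2
      obtain ⟨j, hj⟩ : ∃ j : Fin k, (j : ℕ) = i + 1 := ⟨⟨i + 1, hlt⟩, rfl⟩
      have ihj := ih j (Fin.lt_def.2 (by omega))
      have hU : constantCoeff (linHat s ε γ j * lam j * reflectShift (rhoInt s i : ℂ) (lam i)) ≠
          0 := by
        rw [map_mul, map_mul, constantCoeff_reflectShift (hlam i), hlam, mul_one, mul_one]
        exact constantCoeff_linHat_ne_zero γ j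
      apply smul_cancel_of_constantCoeff_ne_zero hU
      exact smul_eq_of_ratio (hratio i j hj) ihj (hshift i j hj)
  induction i using WellFoundedGT.induction with
  | ind i ih =>
  have h := (hd i).trans (key i).symm
  rw [Finset.sum_congr rfl fun a ha => by rw [ih a (Finset.mem_Ioi.1 ha), smul_smul],
    ← Finset.sum_smul, muHat, add_smul, smul_smul, add_left_inj, mul_smul] at h
  exact smul_cancel_of_constantCoeff_ne_zero (by simp [map_ofNat constantCoeff]) h

end Weights

/-! ### Finite-dimensionality of the irreducible quotient -/

section Verma

open PowerSeries

variable {k : ℕ} {s ε : Fin k → ℤˣ} {μ : Fin k → ℂ⟦X⟧}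

/-- If a representation contains a vector of highest weight `μ`, then `V(μ)` is a quotient of the
subrepresentation which it generates. -/
theorem finiteDimensional_of_highestWeightVector {L : Type*} [AddCommGroup L] [Module ℂ L]
    [FiniteDimensional ℂ L] (φ : B s ε →ₐ[ℂ] Module.End ℂ L) {ξ : L} (hξ : ξ ≠ 0)
    (hup : ∀ i j, i < j → ∀ n : ℕ, φ (b s ε i j n) ξ = 0)
    (hdiag : ∀ i (n : ℕ), φ (b s ε i i n) ξ = coeff n (μ i) • ξ) :
    FiniteDimensional ℂ (V s ε μ) := by
  -- the annihilator of `ξ`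
  let N : Submodule (B s ε) (B s ε) :=
    { carrier := {x | φ x ξ = 0}
      add_mem' := fun {x y} hx hy => by
        rw [Set.mem_ofPred_eq] at hx hy ⊢
        rw [map_add, LinearMap.add_apply, hx, hy, add_zero]
      zero_mem' := by rw [Set.mem_ofPred_eq, map_zero, LinearMap.zero_apply]
      smul_mem' := fun c x hx => by
        rw [Set.mem_ofPred_eq] at hx ⊢
        rw [smul_eq_mul, map_mul, Module.End.mul_apply, hx, map_zero] }
  have hN : vermaIdeal s ε μ ≤ N := by
    refine Submodule.span_le.2 ?_
    rintro x (⟨i, j, hij, n, rfl⟩ | ⟨i, n, rfl⟩)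
    · exact hup i j hij n
    · change φ _ ξ = 0
      rw [map_sub, LinearMap.sub_apply, hdiag, AlgHom.commutes, Module.algebraMap_end_apply,
        sub_self]
  have hNr : N.map (vermaIdeal s ε μ).mkQ ≤ vermaRadical s ε μ := by
    refine le_sSup fun h => hξ ?_
    have h1 : (1 : B s ε) ∈ (N.map (vermaIdeal s ε μ).mkQ).comap (vermaIdeal s ε μ).mkQ := by
      rw [h]; trivial
    rw [Submodule.comap_map_mkQ, sup_eq_right.2 hN] at h1
    replace h1 : φ 1 ξ = 0 := h1
    rwa [map_one] at h1
  let ψ : B s ε →ₗ[ℂ] V s ε μ :=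
    ((vermaRadical s ε μ).mkQ ∘ₗ (vermaIdeal s ε μ).mkQ).restrictScalars ℂ
  let ev : B s ε →ₗ[ℂ] L := (LinearMap.applyₗ ξ) ∘ₗ φ.toLinearMap
  have hψ : Function.Surjective ψ :=
    (Submodule.mkQ_surjective _).comp (Submodule.mkQ_surjective _)
  have hker : LinearMap.ker ev ≤ LinearMap.ker ψ := fun x hx =>
    (Submodule.Quotient.mk_eq_zero _).2 (hNr (Submodule.mem_map_of_mem (show x ∈ N from hx)))
  have : FiniteDimensional ℂ (B s ε ⧸ LinearMap.ker ev) :=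
    Module.Finite.equiv ev.quotKerEquivRange.symm
  refine Module.Finite.of_surjective ((LinearMap.ker ev).liftQ ψ hker) ?_
  rw [← LinearMap.range_eq_top, Submodule.range_liftQ, LinearMap.range_eq_top]
  exact hψ

/-- The unitarity relation forces `μ_i(u) μ_i(-u) = 1` for the last index `i`, unless the Verma
module vanishes. -/
theorem finiteDimensional_of_mul_negX_ne_one {i : Fin k} (hi : ∀ a, a ≤ i)
    (h : μ i * negX (μ i) ≠ 1) : FiniteDimensional ℂ (V s ε μ) := by
  obtain ⟨n, hn⟩ : ∃ n, coeff n (μ i * negX (μ i)) ≠ coeff n (1 : ℂ⟦X⟧) := by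
    by_contra! hc
    exact h (PowerSeries.ext hc)
  let ψ : B s ε →ₗ[B s ε] Verma s ε μ := (vermaIdeal s ε μ).mkQ
  have hup : ∀ a, a < i → ∀ m : ℕ, ψ (b s ε a i m) = 0 := fun a ha m =>
    (Submodule.Quotient.mk_eq_zero _).2 (Submodule.subset_span (Or.inl ⟨a, i, ha, m, rfl⟩))
  have hdiag : ∀ m : ℕ, ψ (b s ε i i m) = algebraMap ℂ (B s ε) (coeff m (μ i)) • ψ 1 := fun m => by
    have := (Submodule.Quotient.mk_eq_zero _).2
      (Submodule.subset_span (Or.inr ⟨i, m, rfl⟩) : _ ∈ vermaIdeal s ε μ)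
    change ψ (_ - _) = 0 at this
    rw [map_sub, sub_eq_zero] at this
    rw [this, ← map_smul, smul_eq_mul, mul_one]
  have hrel : ∑ r ∈ Finset.range (n + 1), ((-1 : ℂ) ^ r) •
      ∑ a, b s ε i a (((n - r : ℕ)) : ℤ) * b s ε a i (r : ℕ) = if n = 0 then 1 else 0 := by
    have h1 := RingQuot.mkAlgHom_rel ℂ (BRel.unitary (s := s) (ε := ε) i i n)
    rw [map_sum] at h1
    simp only [map_smul, bbFree, map_sum, map_mul, true_and] at h1
    rw [apply_ite (RingQuot.mkAlgHom ℂ (BRel s ε)), map_one, map_zero] at h1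
    rw [← h1]
    refine Finset.sum_congr rfl fun r hr => ?_
    rw [Nat.cast_sub (Nat.lt_succ_iff.1 (Finset.mem_range.1 hr))]
    rfl
  have h2 : algebraMap ℂ (B s ε) (coeff n (μ i * negX (μ i)) - coeff n (1 : ℂ⟦X⟧)) • ψ 1 = 0 := by
    have h3 := congrArg ψ hrel
    rw [map_sum] at h3
    have h4 : ∀ r ∈ Finset.range (n + 1), ψ (((-1 : ℂ) ^ r) •
        ∑ a, b s ε i a (((n - r : ℕ)) : ℤ) * b s ε a i (r : ℕ)) =
        algebraMap ℂ (B s ε) (coeff (n - r) (μ i) * coeff r (negX (μ i))) • ψ 1 := by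
      intro r _
      rw [Algebra.smul_def, ← smul_eq_mul, map_smul, map_sum, Finset.sum_eq_single i,
        ← smul_eq_mul, map_smul, hdiag]
      · have hb : b s ε i i (n - r : ℕ) • ψ 1 = ψ (b s ε i i (n - r : ℕ)) := by
          rw [← map_smul, smul_eq_mul, mul_one]
        rw [smul_smul (b s ε i i _), ← Algebra.commutes, ← smul_smul, hb, hdiag, coeff_negX,
          smul_smul, smul_smul, ← map_mul, ← map_mul]
        congr 2
        rw [zsmul_eq_mul]
        push_cast
        ring
      · intro a _ ha
        rw [← smul_eq_mul, map_smul, hup a (lt_of_le_of_ne (hi a) ha), smul_zero]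
      · simp
    rw [Finset.sum_congr rfl h4, ← Finset.sum_smul, ← map_sum] at h3
    rw [map_sub, sub_smul, coeff_mul, ← Finset.Nat.sum_antidiagonal_swap,
      Finset.Nat.sum_antidiagonal_eq_sum_range_succ_mk, coeff_one, sub_eq_zero]
    refine h3.trans ?_
    split_ifs <;> simp
  have h1 : ψ 1 = 0 := by
    have h5 := congrArg (algebraMap ℂ (B s ε) (coeff n (μ i * negX (μ i)) - coeff n 1)⁻¹ • ·) h2
    rwa [smul_zero, smul_smul, ← map_mul, inv_mul_cancel₀ (sub_ne_zero.2 hn), map_one,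
      one_smul] at h5
  have htop : vermaIdeal s ε μ = ⊤ :=
    (Ideal.eq_top_iff_one _).2 ((Submodule.Quotient.mk_eq_zero _).1 h1)
  have : Subsingleton (Verma s ε μ) := Submodule.Quotient.subsingleton_iff.2 htop
  have : Subsingleton (V s ε μ) := (Submodule.mkQ_surjective (vermaRadical s ε μ)).subsingleton
  infer_instance

end Verma

section Conclusion

open PowerSeries

variable {k : ℕ} {s ε : Fin k → ℤˣ}

/-- The scalar series `h(u)` for which the last diagonal entry of `h(u) (ε + γ u⁻¹)` is
`μ_k(u) λ_k(-u) λ_k(u)⁻¹`. -/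
theorem exists_scalar_series {μ lam : Fin k → ℂ⟦X⟧} (γ : ℂ)
    (hμ : ∀ i, constantCoeff (μ i) = ((ε i : ℤ) : ℂ)) (hlam : ∀ i, constantCoeff (lam i) = 1)
    {i : Fin k} (hi : ∀ a, a ≤ i) (h1 : μ i * negX (μ i) = 1) :
    ∃ h : ℂ⟦X⟧, constantCoeff h = 1 ∧ h * negX h * (1 - C (γ ^ 2) * X ^ 2) = 1 ∧
      ∀ j : Fin k, (∀ a, a ≤ j) →
        μ j * negX (lam j) = h * (C ((ε j : ℤ) : ℂ) + C γ * X) * lam j := by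
  set q : ℂ⟦X⟧ := (C ((ε i : ℤ) : ℂ) + C γ * X) * lam i with hq
  have hq0 : constantCoeff q = ((ε i : ℤ) : ℂ) := by simp [hq, hlam]
  have hqi : q * q⁻¹ = 1 := PowerSeries.mul_inv_cancel _ (by rw [hq0]; exact sign_ne_zero _)
  have hneg : ∀ f : ℂ⟦X⟧, constantCoeff (negX f) = constantCoeff f := fun f => by
    rw [← coeff_zero_eq_constantCoeff_apply, coeff_negX, pow_zero, one_smul,
      coeff_zero_eq_constantCoeff_apply]
  have hh : μ i * negX (lam i) = μ i * negX (lam i) * q⁻¹ * q := by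
    linear_combination -(μ i * negX (lam i)) * hqi
  refine ⟨μ i * negX (lam i) * q⁻¹, ?_, ?_, ?_⟩
  · have := congrArg constantCoeff hh
    rw [map_mul _ _ q, map_mul _ (μ i), hneg, hμ, hlam, hq0, mul_one] at this
    exact mul_right_cancel₀ (sign_ne_zero (ε i)) (by rw [one_mul, ← this])
  · generalize μ i * negX (lam i) * q⁻¹ = h at hh
    have hh' := congrArg negX hh
    rw [hq, ← mul_assoc] at hh
    simp only [hq, map_mul, map_add, negX_negX, negX_C, negX_X] at hh'
    have hs : (C ((ε i : ℤ) : ℂ) : ℂ⟦X⟧) * C ((ε i : ℤ) : ℂ) = 1 := by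
      rw [← map_mul, sign_mul_self, map_one]
    have hu : constantCoeff (lam i * negX (lam i)) ≠ 0 := by
      rw [map_mul, hneg, hlam, mul_one]; exact one_ne_zero
    apply mul_left_cancel₀ (a := lam i * negX (lam i)) (fun h0 => hu (by rw [h0, map_zero]))
    rw [map_pow]
    linear_combination (lam i * negX (lam i)) * h1 - (negX (μ i) * lam i) * hh -
      (h * (C ((ε i : ℤ) : ℂ) + C γ * X) * lam i) * hh' - lam i * negX (lam i) * h * negX h * hs
  · intro j hj
    obtain rfl : j = i := le_antisymm (hi j) (hj i)
    rw [mul_assoc _ _ (lam j)]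
    exact hh

/-- The highest weight vector of a representation of the super Yangian is a highest weight vector
of weight `μ` for the action of the twisted super Yangian through `T(u) K(u) T(-u)⁻¹`. -/
theorem exists_hom_highestWeightVector {μ lam : Fin k → ℂ⟦X⟧} {γ : ℂ} {h : ℂ⟦X⟧}
    (hlam : ∀ i, constantCoeff (lam i) = 1)
    (hratio : ∀ i j : Fin k, (j : ℕ) = i + 1 →
      muHat s μ i * (linHat s ε γ j * lam j * reflectShift (rhoInt s i : ℂ) (lam i)) =
        muHat s μ j * (linHat s ε γ i * lam i * reflectShift (rhoInt s i : ℂ) (lam j)))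
    (hh0 : constantCoeff h = 1) (hh : h * negX h * (1 - C (γ ^ 2) * X ^ 2) = 1)
    (hlast : ∀ i : Fin k, (∀ a, a ≤ i) →
      μ i * negX (lam i) = h * (C ((ε i : ℤ) : ℂ) + C γ * X) * lam i)
    {L : Type*} [AddCommGroup L] [Module ℂ L] [Module (Y s) L] [IsScalarTower ℂ (Y s) L]
    {ξ : L} (hξ : IsHighestWeightVector s lam ξ) :
    ∃ φ : B s ε →ₐ[ℂ] Module.End ℂ L, (∀ i j, i < j → ∀ n : ℕ, φ (b s ε i j n) ξ = 0) ∧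
      ∀ i (n : ℕ), φ (b s ε i i n) ξ = coeff n (μ i) • ξ := by
  -- a rank one projection onto the line of `ξ` replaces `ξ` by an element of `Module.End ℂ L`
  obtain ⟨g, hg⟩ : ∃ g : L →ₗ[ℂ] ℂ, g ξ = 1 := by
    obtain ⟨g, hg⟩ := (LinearMap.toSpanSingleton ℂ L ξ).exists_leftInverse_of_injective
      (LinearMap.ker_toSpanSingleton ℂ hξ.ne_zero)
    exact ⟨g, by simpa using LinearMap.congr_fun hg 1⟩
  set e : Module.End ℂ L := g.smulRight ξ with he
  have hmul : ∀ a : Module.End ℂ L, a * e = g.smulRight (a ξ) := fun a => by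
    ext x
    simp [he]
  have heξ : e ξ = ξ := by simp [he, hg]
  let f : Y s →ₐ[ℂ] Module.End ℂ L := Algebra.lsmul ℂ ℂ L
  have hf : ∀ y, f y ξ = y • ξ := fun y => rfl
  have hT := isRTT_tSeries f
  obtain ⟨S, hTS, hST, hS0⟩ := exists_matrix_inverse (tSeries f) (tSeries_constantCoeff f)
  have hup : ∀ i j, i < j → tSeries f i j * C e = 0 := fun i j hij => by
    ext1 n
    rw [coeff_mul_C, tSeries, Matrix.of_apply, coeff_mk, hmul, hf, hξ.upper i j hij]
    ext x
    simp
  have hdiag : ∀ i, tSeries f i i * C e = lam i • (C e : (Module.End ℂ L)⟦X⟧) := fun i => by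
    ext1 n
    rw [coeff_mul_C, tSeries, Matrix.of_apply, coeff_mk, hmul, hf, hξ.diag, series_smul_C]
    refine LinearMap.ext fun x => ?_
    rw [LinearMap.smul_apply, he, LinearMap.smulRight_apply, LinearMap.smulRight_apply, smul_comm]
  have hlow := inv_upper hT hTS hST hup hdiag hlam
  obtain ⟨φ, hφ⟩ := exists_hom_dressed (ε := ε) hT (tSeries_constantCoeff f) hS0 hTS hST hh0 hh
  have happ : ∀ (a : Module.End ℂ L), a ξ = (a * e) ξ := fun a => by
    rw [Module.End.mul_apply, heξ]
  refine ⟨φ, fun i j hij n => ?_, fun i n => ?_⟩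
  · rw [hφ, happ, ← coeff_mul_C, dressed_upper hT hTS hST hup hlow hij]
    simp
  · have hd := eq_smul_of_recursion hlam hratio hlast
      (fun i hi => inv_diag_last hST hup hdiag hi)
      (fun i j hij => inv_diag_shift hT hTS hST hup hdiag hlow hij)
      (fun i => dressed_diag_series (γ := γ) (h := h) (ε := ε) hT hTS hST hup hdiag hlow i) i
    rw [hφ, happ, ← coeff_mul_C, hd, series_smul_C]
    rw [LinearMap.smul_apply, heξ]

end Conclusion

end SuperYangian

open SuperYangian in
theorem mainTheorem7 {k : ℕ} (s ε : Fin k → ℤˣ)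
    (μ : Fin k → PowerSeries ℂ) (hμ : ∀ i, PowerSeries.constantCoeff (μ i) = ((ε i : ℤ) : ℂ))
    (γ : ℂ)
    (lam : Fin k → PowerSeries ℂ) (hlam : ∀ i, PowerSeries.constantCoeff (lam i) = 1)
    (L : Type*) [AddCommGroup L] [Module ℂ L] [Module (Y s) L] [IsScalarTower ℂ (Y s) L]
    (hL : IsIrreducibleHighestWeight s lam L) (hfin : FiniteDimensional ℂ L)
    (hratio : ∀ i j : Fin k, (j : ℕ) = (i : ℕ) + 1 →
      muTilde s μ i / muTilde s μ j =
        (linFactor s ε γ i * toLaurent (lam i) * toLaurent (reflectShift (rhoSucc s i) (lam j))) /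
        (linFactor s ε γ j * toLaurent (lam j) *
          toLaurent (reflectShift (rhoSucc s i) (lam i)))) :
    FiniteDimensional ℂ (V s ε μ) := by
  obtain ⟨ξ, hξ⟩ := hL.exists_highest
  have hratio' : ∀ i j : Fin k, (j : ℕ) = i + 1 →
      muHat s μ i * (linHat s ε γ j * lam j * reflectShift (rhoInt s i : ℂ) (lam i)) =
        muHat s μ j * (linHat s ε γ i * lam i * reflectShift (rhoInt s i : ℂ) (lam j)) :=
    fun i j hij => muHat_mul_eq hμ hlam (hratio i j hij)
  rcases k with _ | k
  · -- without generators, `V(μ)` is a quotient of `ℂ`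
    obtain ⟨φ, hup, hdiag⟩ := exists_hom_highestWeightVector (ε := ε) (γ := 0) (h := 1) hlam
      (fun i => i.elim0) (map_one _) (by simp) (fun i => i.elim0) hξ
    exact finiteDimensional_of_highestWeightVector φ hξ.ne_zero hup hdiag
  · have hi : ∀ a, a ≤ Fin.last k := Fin.le_last
    by_cases h1 : μ (Fin.last k) * negX (μ (Fin.last k)) = 1
    · obtain ⟨h, hh0, hh, hlast⟩ := exists_scalar_series γ hμ hlam hi h1
      obtain ⟨φ, hup, hdiag⟩ := exists_hom_highestWeightVector hlam hratio' hh0 hh hlast hξ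
      exact finiteDimensional_of_highestWeightVector φ hξ.ne_zero hup hdiag
    · exact finiteDimensional_of_mul_negX_ne_one hi h1
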